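/- **Setting.** Let $d,k\ge 1$, $2\le K\le h$, $m\ge 1$ be integers and $B>0$. For $v=(v_0,\dots,v_{k-1})\in\mathbb R^k$ let $\mathrm{toep}(v)\in\mathbb R^{h\times h}$ be the banded Toeplitz matrix with $[\mathrm{toep}(v)]_{i,j}=v_{j-i}$ if $0\le j-i\le k-1$ and $0$ otherwise. For kernels $w=(w_1,\dots,w_d)\in(\mathbb R^k)^d$ put $W_l=\mathrm{toep}(w_l)$ and let $f_w(x)\in\mathbb R^K$ consist of the first $K$ coordinates (all of them if $K=h$) of $W_d\,\phi(W_{d-1}\phi(\cdots\phi(W_1x)))$, where $\phi$ is the coordinatewise ReLU and $x\in\mathbb R^h$, $\|x\|_2\le B$. For a probability distribution $\mathcal D$ of pairs $(x,y)$ with $\|x\|_2\le B$ and $y\in\{1,\dots,K\}$ let $L_\gamma(f)=\mathbb P_{(x,y)\sim\mathcal D}\big[f(x)[y]\le\gamma+\max_{j\ne y}f(x)[j]\big]$, and let $\hat L_\gamma(f)$ be its empirical counterpart on $m$ i.i.d. samples from $\mathcal D$. Let $T\in\mathbb R^{h^2\times h^2}$, $T_{pq}=t_{p-q}$, be a real Toeplitz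 matrix with absolutely summable coefficients $(t_n)_{n\in\mathbb Z}$ and symbol $\psi(\omega)=\sum_{n\in\mathbb Z} t_ne^{-\mathrm i n\omega}$ such that $0<\psi_{\min}\le|\psi(\omega)|\le\psi_{\max}$ for all $\omega\in[0,2\pi]$. Let $P\in\{0,1\}^{h^2\times k}$ be the matrix with $\mathrm{vec}(\mathrm{toep}(v))=Pv$, where $\mathrm{vec}$ puts the entry $(i,q)$, $0\le i,q<h$, at position $ih+q$. Take the sensitivity matrices $$A_l=\frac{e\sqrt d\,B\prod_{i\ne l}\|W_i\|_2}{\psi_{\min}}\,TP\in\mathbb R^{h^2\times k},$$ where $\|\cdot\|_2$ is the spectral norm, and the kernel spectral complexity $$\Phi^{\mathrm{toep}}(w)=\frac{\psi_{\max}^2}{\psi_{\min}^2}\sum_{l=1}^d\|w_l\|_2^2\prod_{i\ne l}\|w_i\|_1^2 .$$ **Theorem.** There is a universal constant $C>0$ such that in every such setting the following holds. 1. If $\psi$ is real-valued, then $(A_l)$ dominates the output perturbation: for all $w,u\in(\mathbb R^k)^d$ with $\|\mathrm{toep}(u_l)\|_2\le\frac1d\|\mathrm{toep}(w_l)\|_2$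 for all $l$, and all $\|x\|_2\le B$, $$\|f_{w+u}(x)-f_w(x)\|_\infty^2\le\sum_{l=1}^d\|A_lu_l\|_2^2 .$$ 2. For every $\mathcal D$ and all $\gamma,\delta>0$, with probability at least $1-\delta$ over the sample, for all $w\in(\mathbb R^k)^d$ simultaneously, $$L_0(f_w)\le\hat L_\gamma(f_w)+C\sqrt{\frac{B^2d^2k\,\Phi^{\mathrm{toep}}(w)+\max\{1,\gamma^2\}\,\ln\frac{md}{\delta}}{\gamma^2m}} .$$ In particular, for $\gamma\le1$ the second term is $O\Big(\sqrt{\frac{B^2d^2k\,\Phi^{\mathrm{toep}}(w)+\ln(md/\delta)}{\gamma^2m}}\Big)$ with an absolute constant. -/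

import Mathlib

open MeasureTheory

noncomputable section

namespace ToepNet

/-- The upper banded Toeplitz matrix of a kernel `v`: the `(i, j)` entry is `v_{j - i}` if
`0 ≤ j - i ≤ k - 1`, and `0` otherwise. -/
def toep (h : ℕ) {k : ℕ} (v : Fin k → ℝ) : Matrix (Fin h) (Fin h) ℝ :=
  Matrix.of fun i j =>
    if hij : (i : ℕ) ≤ j ∧ (j : ℕ) - i < k then v ⟨(j : ℕ) - i, hij.2⟩ else 0

/-- Vectorization of a square matrix: the entry `(i, q)` is placed at position `i * h + q`. -/
def vec {h : ℕ} (M : Matrix (Fin h) (Fin h) ℝ) : Fin (h * h) → ℝ :=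
  fun p => M (finProdFinEquiv.symm p).1 (finProdFinEquiv.symm p).2

/-- The sparse binary `h² × k` matrix mapping a kernel to its vectorized Toeplitz matrix: column `c`
has a `1` at position `i * h + q` exactly when `q - i = c`. -/
def kernelMap (h k : ℕ) : Matrix (Fin (h * h)) (Fin k) ℝ :=
  Matrix.of fun p c =>
    if ((finProdFinEquiv.symm p).2 : ℕ) = (finProdFinEquiv.symm p).1 + c then 1 else 0

theorem vec_toep (h : ℕ) {k : ℕ} (v : Fin k → ℝ) :
    vec (toep h v) = (kernelMap h k).mulVec v := by
  funext p
  simp only [vec, toep, kernelMap, Matrix.mulVec, dotProduct, Matrix.of_apply, ite_mul, one_mul,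
    zero_mul]
  split_ifs with hij
  · rw [Finset.sum_eq_single (⟨_, hij.2⟩ : Fin k)]
    · rw [if_pos]
      simp only
      omega
    · intro c _ hc
      rw [if_neg]
      intro hq
      apply hc
      ext
      simp only
      omega
    · intro hc
      exact absurd (Finset.mem_univ _) hc
  · symm
    apply Finset.sum_eq_zero
    intro c _
    rw [if_neg]
    intro hq
    apply hij
    have := c.2
    omega

/-- The `n × n` section of the Toeplitz operator with coefficients `t`. -/
def toeplitzSection (n : ℕ) (t : ℤ → ℝ) : Matrix (Fin n) (Fin n) ℝ :=
  Matrix.of fun p q => t ((p : ℤ) - (q : ℤ))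

/-- The symbol (generating function) `ψ(ω) = ∑ i, t i * exp (-i ω √-1)`. -/
def symbol (t : ℤ → ℝ) (ω : ℝ) : ℂ :=
  ∑' i : ℤ, (t i : ℂ) * Complex.exp (-(i : ℂ) * (ω : ℂ) * Complex.I)

/-- Spectral norm: the operator norm with respect to the Euclidean norms. -/
def specNorm {h : ℕ} (M : Matrix (Fin h) (Fin h) ℝ) : ℝ :=
  ‖Matrix.toEuclideanCLM (n := Fin h) (𝕜 := ℝ) M‖

/-- The bias-free ReLU network
`x ↦ W_d φ(W_{d-1} φ(⋯ φ(W_1 x)))` (there is no activation after the last layer);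
`W 0` is the first layer. -/
def network {h : ℕ} :
    (d : ℕ) → (Fin d → Matrix (Fin h) (Fin h) ℝ) → (Fin h → ℝ) → (Fin h → ℝ)
  | 0, _, x => x
  | 1, W, x => (W 0).mulVec x
  | d + 2, W, x =>
      (W (Fin.last (d + 1))).mulVec
        (fun i => max 0 (network (d + 1) (fun l => W l.castSucc) x i))

/-- The convolutional network with kernels `w`, all of whose weight matrices are `toep h (w l)`.
Its `K ≤ h` outputs are the first `K` coordinates of the last layer (all of them if `K = h`). -/
def convNet {d h k K : ℕ} (hK : K ≤ h) (w : Fin d → Fin k → ℝ)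
    (x : EuclideanSpace ℝ (Fin h)) : Fin K → ℝ :=
  fun j => network d (fun l => toep h (w l)) (fun i => x i) (Fin.castLE hK j)

/-- The sensitivity matrix
`A_l = (e √d B ∏_{i ≠ l} ‖W_i‖₂ / ψ_min) T P` of size `h² × k`. -/
def sensitivity {d h k : ℕ} (B ψmin : ℝ) (t : ℤ → ℝ) (w : Fin d → Fin k → ℝ) (l : Fin d) :
    Matrix (Fin (h * h)) (Fin k) ℝ :=
  (Real.exp 1 * √(d : ℝ) * B * (∏ i ∈ Finset.univ.erase l, specNorm (toep h (w i))) / ψmin) •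
    (toeplitzSection (h * h) t * kernelMap h k)

/-- The kernel spectral complexity
`(ψ_max² / ψ_min²) ∑_l ‖w_l‖₂² ∏_{i ≠ l} ‖w_i‖₁²`. -/
def kernelComplexity {d k : ℕ} (ψmin ψmax : ℝ) (w : Fin d → Fin k → ℝ) : ℝ :=
  ψmax ^ 2 / ψmin ^ 2 *
    ∑ l, (∏ i ∈ Finset.univ.erase l, (∑ c, |w i c|) ^ 2) * ∑ c, w l c ^ 2

/-- The example `z = (x, y)` is lost at margin `γ`: `f(x)[y] ≤ γ + max_{j ≠ y} f(x)[j]`. -/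
def marginError {h K : ℕ} (γ : ℝ) (f : EuclideanSpace ℝ (Fin h) → Fin K → ℝ) :
    Set (EuclideanSpace ℝ (Fin h) × Fin K) :=
  {z | ∃ j, j ≠ z.2 ∧ f z.1 z.2 ≤ γ + f z.1 j}

/-- Expected margin loss. -/
def marginLoss {h K : ℕ} (D : Measure (EuclideanSpace ℝ (Fin h) × Fin K)) (γ : ℝ)
    (f : EuclideanSpace ℝ (Fin h) → Fin K → ℝ) : ℝ :=
  ∫ z, (marginError γ f).indicator (fun _ => (1 : ℝ)) z ∂D

/-- Empirical margin loss over a sample of size `m`. -/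
def empMarginLoss {h K m : ℕ} (S : Fin m → EuclideanSpace ℝ (Fin h) × Fin K) (γ : ℝ)
    (f : EuclideanSpace ℝ (Fin h) → Fin K → ℝ) : ℝ :=
  (∑ i, (marginError γ f).indicator (fun _ => (1 : ℝ)) (S i)) / m

end ToepNet

end

/-! Domination. Replacing the layers one at a time bounds the change of output by `(1 + 1/d)^d ≤ e`
times `B ∑ l, ‖U_l‖₂ ∏ i ≠ l, ‖W_i‖₂` (`norm_network_add_sub_le`); Cauchy–Schwarz over the layers
gives the factor `√d`. The spectral norm of `U_l` is at most its Frobenius norm `‖P u_l‖₂`. A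
continuous real symbol with `|ψ| ≥ ψmin > 0` has constant sign, so the quadratic form of `T`, an
integral of `ψ` against `|∑ v_p e^{ipω}|²`, is at least `ψmin ‖v‖²` in absolute value. Hence `‖T v‖
≥ ψmin ‖v‖` (`mul_sum_sq_le_toeplitz`).

Generalization. By positive homogeneity all kernels may be scaled to `‖v_l‖₁ = 1`; each layer is
then an `ℓ²` contraction. Maurey sampling replaces `v_l` by an average of `N` random signed
coordinate vectors, at mean square output error at most `d ‖x‖² / N` (`sum_sampled_network_le`). For
`N` of order `d B² / θ²`, the probability that the sampled network errs at margin `θ/2` is at least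
`3/4` on errors of the mean network and at most `1/4` off its `θ`-margin errors, so a ramp of this
probability lies between the two losses. That probability is a mixture of finitely many fixed
indicators, and the mixing law is close to uniform in the chi-square sense, with exponent `κ = N k ∑
‖v_l‖₂²`. A change of measure to the uniform law bounds the exponential moment of the Rademacher
supremum by `exp (κ + O(m))` for all kernels at once (`sum_exp_iSup_mixture`). Contraction removes
the ramp, symmetrization and Markov's inequality give the deviation bound, and a union bound over
`m²` scales finishes. The ratio `ψmax² / ψmin² ≥ 1` only enlarges the bound. -/

noncomputable section

namespace ToepNet

/-! ### Sums against product weights on finite spaces. -/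

section ProductSums

variable {A : Type*} [Fintype A]

theorem sum_prod_mul_cons {n : ℕ} (q : Fin (n + 1) → A → ℝ) (F : (Fin (n + 1) → A) → ℝ) :
    ∑ ω, (∏ i, q i (ω i)) * F ω =
      ∑ a, q 0 a * ∑ ω : Fin n → A, (∏ i, q i.succ (ω i)) * F (Fin.cons a ω) := by
  rw [← (Fin.consEquiv fun _ => A).sum_comp, Fintype.sum_prod_type]
  refine Finset.sum_congr rfl fun a _ => ?_
  rw [Finset.mul_sum]
  refine Finset.sum_congr rfl fun ω _ => ?_
  simp [Fin.consEquiv, Fin.prod_univ_succ, mul_assoc]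

theorem sum_prod_mul_snoc {n : ℕ} (q : Fin (n + 1) → A → ℝ) (F : (Fin (n + 1) → A) → ℝ) :
    ∑ ω, (∏ i, q i (ω i)) * F ω =
      ∑ ω : Fin n → A, (∏ i, q i.castSucc (ω i)) *
        ∑ a, q (Fin.last n) a * F (Fin.snoc ω a : Fin (n + 1) → A) := by
  rw [← (Fin.snocEquiv fun _ => A).sum_comp, Fintype.sum_prod_type_right]
  refine Finset.sum_congr rfl fun ω _ => ?_
  rw [Finset.mul_sum]
  refine Finset.sum_congr rfl fun a _ => ?_
  simp [Fin.snocEquiv, Fin.prod_univ_castSucc, mul_assoc]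

theorem sum_prod_apply {ι : Type*} [Fintype ι] [DecidableEq ι] (q : ι → A → ℝ) :
    ∑ ω : ι → A, ∏ i, q i (ω i) = ∏ i, ∑ a, q i a := by
  rw [Finset.prod_univ_sum, Fintype.piFinset_univ]

theorem sum_prod_apply_eq_one {ι : Type*} [Fintype ι] [DecidableEq ι] {q : ι → A → ℝ}
    (hq : ∀ i, ∑ a, q i a = 1) : ∑ ω : ι → A, ∏ i, q i (ω i) = 1 := by
  rw [sum_prod_apply, Finset.prod_congr rfl fun i _ => hq i, Finset.prod_const_one]

theorem sum_prod_mul_apply {ι : Type*} [Fintype ι] [DecidableEq ι] {q : ι → A → ℝ}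
    (hq : ∀ i, ∑ a, q i a = 1) (j : ι) (F : A → ℝ) :
    ∑ ω : ι → A, (∏ i, q i (ω i)) * F (ω j) = ∑ a, q j a * F a := by
  have key : ∀ ω : ι → A, (∏ i, q i (ω i)) * F (ω j) =
      ∏ i, q i (ω i) * (if i = j then F (ω i) else 1) := fun ω => by
    rw [Finset.prod_mul_distrib, Finset.prod_ite_eq' Finset.univ j fun i => F (ω i)]
    simp
  simp_rw [key]
  rw [sum_prod_apply fun i a => q i a * (if i = j then F a else 1),
    Finset.prod_eq_single_of_mem j (Finset.mem_univ j) fun i _ hij => by simp [hij, hq]]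
  simp

/-- Second moment of a sum of independent copies of `X`. -/
theorem sum_prod_mul_sq {q : A → ℝ} (hq : ∑ a, q a = 1) (X : A → ℝ) (N : ℕ) (b : ℝ) :
    ∑ τ : Fin N → A, (∏ t, q (τ t)) * (b + ∑ t, X (τ t)) ^ 2 =
      (b + N * ∑ a, q a * X a) ^ 2 +
        N * (∑ a, q a * X a ^ 2 - (∑ a, q a * X a) ^ 2) := by
  -- The offset `b` is general so that it can absorb the first draw.
  induction N generalizing b with
  | zero => simp
  | succ N ih =>
    rw [sum_prod_mul_cons fun _ => q]
    simp only [Fin.sum_univ_succ, Fin.cons_zero, Fin.cons_succ, ← add_assoc, ih]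
    set μ := ∑ a, q a * X a
    set s := ∑ a, q a * X a ^ 2
    have e : ∀ a, q a * ((b + X a + N * μ) ^ 2 + N * (s - μ ^ 2)) =
        q a * ((b + N * μ) ^ 2 + N * (s - μ ^ 2)) + 2 * (b + N * μ) * (q a * X a) +
          q a * X a ^ 2 := fun a => by ring
    simp_rw [e, Finset.sum_add_distrib, ← Finset.mul_sum, ← Finset.sum_mul, hq]
    push_cast
    ring

end ProductSums

/-- The sign `±1` of a bit. -/
def sgn (b : Bool) : ℝ := if b then 1 else -1

theorem sgn_not (b : Bool) : sgn (!b) = -sgn b := by cases b <;> simp [sgn]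

theorem sum_sgn {M : Type*} [AddCommMonoid M] (F : ℝ → M) : ∑ b, F (sgn b) = F 1 + F (-1) := by
  simp [sgn]

/-! ### Contraction, change of measure and symmetrization for exponential moments. -/

section Suprema

variable {H : Type*} [Finite H]

theorem le_iSup_finite (f : H → ℝ) (h : H) : f h ≤ ⨆ h, f h :=
  le_ciSup (Set.finite_range f).bddAbove h

variable [Nonempty H]

/-- Take maximizers `h₁` of `A + G ∘ b` and `h₂` of `A - G ∘ b`, with values `x ≥ y`. The gaps `p`,
`q` between `L * b` and `G ∘ b` at `h₁`, `h₂` satisfy `p ≥ q ≥ 0` once `b h₂ ≤ b h₁`. Then `e^x (e^p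
- 1) ≥ e^x p ≥ e^y q ≥ e^y (1 - e^{-q})`. -/
theorem exp_iSup_contract_one {G : ℝ → ℝ} {L : ℝ} (hG0 : G 0 = 0) (hGm : Monotone G)
    (hGL : ∀ x y, x ≤ y → G y - G x ≤ L * (y - x)) (A b : H → ℝ) (hb : ∀ h, 0 ≤ b h) :
    Real.exp (⨆ h, (A h + G (b h))) + Real.exp (⨆ h, (A h - G (b h))) ≤
      Real.exp (⨆ h, (A h + L * b h)) + Real.exp (⨆ h, (A h - L * b h)) := by
  have hnn : ∀ h, 0 ≤ G (b h) := fun h => hG0 ▸ hGm (hb h)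
  have hle : ∀ h, G (b h) ≤ L * b h := fun h => by
    have := hGL 0 (b h) (hb h); rw [hG0] at this; simpa using this
  obtain ⟨h₁, e₁⟩ := exists_eq_ciSup_of_finite (f := fun h => A h + G (b h))
  obtain ⟨h₂, e₂⟩ := exists_eq_ciSup_of_finite (f := fun h => A h - G (b h))
  have key : ∃ h₂, A h₂ - G (b h₂) = (⨆ h, (A h - G (b h))) ∧ b h₂ ≤ b h₁ := by
    rcases le_total (b h₂) (b h₁) with hle | hle
    · exact ⟨h₂, e₂, hle⟩
    · refine ⟨h₁, ?_, le_rfl⟩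
      have a1 := le_iSup_finite (fun h => A h + G (b h)) h₂
      have a2 := le_iSup_finite (fun h => A h - G (b h)) h₁
      have := hGm hle
      linarith
  obtain ⟨h₂, e₂, h12⟩ := key
  have a1 := le_iSup_finite (fun h => A h + G (b h)) h₂
  have r1 := Real.exp_le_exp.2 (le_iSup_finite (fun h => A h + L * b h) h₁)
  have r2 := Real.exp_le_exp.2 (le_iSup_finite (fun h => A h - L * b h) h₂)
  rw [← e₁] at a1 ⊢
  rw [← e₂]
  have hd : L * b h₂ - G (b h₂) ≤ L * b h₁ - G (b h₁) := by
    have := hGL _ _ h12; linarith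
  set x := A h₁ + G (b h₁)
  set y := A h₂ - G (b h₂)
  have hxy : y ≤ x := by have := hnn h₂; simp only [x, y]; linarith
  have q1 : Real.exp (A h₁ + L * b h₁) = Real.exp x * Real.exp (L * b h₁ - G (b h₁)) := by
    rw [← Real.exp_add]; congr 1; simp only [x]; ring
  have q2 : Real.exp (A h₂ - L * b h₂) = Real.exp y * Real.exp (-(L * b h₂ - G (b h₂))) := by
    rw [← Real.exp_add]; congr 1; simp only [y]; ring
  rw [q1] at r1
  rw [q2] at r2
  have s1 := mul_le_mul_of_nonneg_left
    (Real.add_one_le_exp (L * b h₁ - G (b h₁))) (Real.exp_pos x).le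
  have s2 := mul_le_mul_of_nonneg_left
    (Real.add_one_le_exp (-(L * b h₂ - G (b h₂)))) (Real.exp_pos y).le
  have s3 : Real.exp y * (L * b h₂ - G (b h₂)) ≤ Real.exp x * (L * b h₁ - G (b h₁)) :=
    mul_le_mul (Real.exp_le_exp.2 hxy) hd (by linarith [hle h₂]) (Real.exp_pos x).le
  linarith

/-- The contraction principle for exponential moments of Rademacher averages. -/
theorem exp_iSup_contract {G : ℝ → ℝ} {L : ℝ} (hG0 : G 0 = 0) (hGm : Monotone G)
    (hGL : ∀ x y, x ≤ y → G y - G x ≤ L * (y - x)) (m : ℕ) (A : H → ℝ) (b : H → Fin m → ℝ)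
    (hb : ∀ h i, 0 ≤ b h i) :
    ∑ ε : Fin m → Bool, Real.exp (⨆ h, (A h + ∑ i, sgn (ε i) * G (b h i))) ≤
      ∑ ε : Fin m → Bool, Real.exp (⨆ h, (A h + ∑ i, sgn (ε i) * (L * b h i))) := by
  -- `A` absorbs the terms of the coordinates not being contracted.
  induction m generalizing A with
  | zero => simp
  | succ m ih =>
    have split : ∀ F : (Fin (m + 1) → Bool) → ℝ,
        ∑ ε, F ε = ∑ e, ∑ ε : Fin m → Bool, F (Fin.cons e ε) := fun F => by
      simpa using sum_prod_mul_cons (A := Bool) (fun _ _ => 1) F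
    rw [split, split]
    simp only [Fin.sum_univ_succ, Fin.cons_zero, Fin.cons_succ]
    calc _ = ∑ e, ∑ ε : Fin m → Bool, Real.exp (⨆ h, ((A h + sgn e * G (b h 0)) +
          ∑ i, sgn (ε i) * G (b h i.succ))) := by simp only [add_assoc]
      _ ≤ ∑ e, ∑ ε : Fin m → Bool, Real.exp (⨆ h, ((A h + sgn e * G (b h 0)) +
          ∑ i, sgn (ε i) * (L * b h i.succ))) :=
        Finset.sum_le_sum fun e _ => ih _ _ fun h i => hb h _
      _ = ∑ ε : Fin m → Bool, ∑ e, Real.exp (⨆ h, ((A h + ∑ i, sgn (ε i) * (L * b h i.succ)) +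
          sgn e * G (b h 0))) := by
        rw [Finset.sum_comm]; simp only [add_right_comm]
      _ ≤ ∑ ε : Fin m → Bool, ∑ e, Real.exp (⨆ h, ((A h + ∑ i, sgn (ε i) * (L * b h i.succ)) +
          sgn e * (L * b h 0))) := by
        refine Finset.sum_le_sum fun ε _ => ?_
        have := exp_iSup_contract_one hG0 hGm hGL
          (fun h => A h + ∑ i, sgn (ε i) * (L * b h i.succ)) (fun h => b h 0) fun h => hb h 0
        simpa [sgn, ← sub_eq_add_neg] using this
      _ = _ := by
        rw [Finset.sum_comm]
        refine Finset.sum_congr rfl fun e _ => Finset.sum_congr rfl fun ε _ => ?_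
        congr 2
        funext h
        ring

/-- Exponential moment of the Rademacher average of mixtures `∑ ω, q h ω * g ω` whose weights are
close to uniform in the chi-square sense. -/
theorem sum_exp_iSup_mixture {Ω Y : Type*} [Fintype Ω] (q : H → Ω → ℝ) (g : Ω → Y → ℝ)
    (hq0 : ∀ h ω, 0 ≤ q h ω) (hq1 : ∀ h, ∑ ω, q h ω = 1) (hg : ∀ ω y, |g ω y| ≤ 1) {κ : ℝ}
    (hκ : ∀ h, Fintype.card Ω * ∑ ω, q h ω ^ 2 ≤ Real.exp (2 * κ)) (c : ℝ) {m : ℕ}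
    (s : Fin m → Y) :
    ∑ ε : Fin m → Bool, Real.exp (⨆ h, ∑ i, sgn (ε i) * (c * ∑ ω, q h ω * g ω (s i))) ≤
      2 ^ m * Real.exp (κ + 2 * c ^ 2 * m) := by
  have hΩ : Nonempty Ω := by
    by_contra hcon
    rw [not_nonempty_iff] at hcon
    simpa using hq1 (Classical.arbitrary H)
  set n : ℝ := (Fintype.card Ω : ℝ)
  have hn : 0 < n := by simp only [n]; exact_mod_cast Fintype.card_pos
  set F : (Fin m → Bool) → Ω → ℝ := fun ε ω => ∑ i, sgn (ε i) * (c * g ω (s i))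
  -- The right side is free of `h`: the supremum disappears here, not through a covering.
  have step : ∀ ε : Fin m → Bool,
      Real.exp (⨆ h, ∑ i, sgn (ε i) * (c * ∑ ω, q h ω * g ω (s i))) ≤
        Real.exp κ / 2 * (1 + (∑ ω, Real.exp (2 * F ε ω)) / n) := by
    intro ε
    obtain ⟨h, e⟩ := exists_eq_ciSup_of_finite
      (f := fun h => ∑ i, sgn (ε i) * (c * ∑ ω, q h ω * g ω (s i)))
    rw [← e]
    have e2 : ∑ i, sgn (ε i) * (c * ∑ ω, q h ω * g ω (s i)) = ∑ ω, q h ω * F ε ω := by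
      simp only [F, Finset.mul_sum]
      rw [Finset.sum_comm]
      exact Finset.sum_congr rfl fun ω _ => Finset.sum_congr rfl fun i _ => by ring
    have jensen : Real.exp (∑ ω, q h ω * F ε ω) ≤ ∑ ω, q h ω * Real.exp (F ε ω) := by
      have := convexOn_exp.map_sum_le (t := Finset.univ) (w := q h) (p := F ε)
        (fun ω _ => hq0 h ω) (hq1 h) fun _ _ => Set.mem_univ _
      simpa using this
    rw [e2]
    refine jensen.trans ?_
    -- Change of measure by AM–GM, balanced by `exp κ`: the `q²` part is paid by `hκ`, the other is
    -- a uniform average.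
    have pt : ∀ ω, q h ω * Real.exp (F ε ω) ≤
        n * q h ω ^ 2 * Real.exp (-κ) / 2 + Real.exp κ * Real.exp (2 * F ε ω) / n / 2 := by
      intro ω
      have h1 : Real.exp (2 * F ε ω) = Real.exp (F ε ω) ^ 2 := by
        rw [← Real.exp_nat_mul]; norm_num
      have h2 : Real.exp (-κ) * Real.exp κ = 1 := by rw [← Real.exp_add]; simp
      have hk := Real.exp_pos κ
      have hk' := Real.exp_pos (-κ)
      rw [h1]
      set E := Real.exp (F ε ω)
      have : n * q h ω ^ 2 * Real.exp (-κ) / 2 + Real.exp κ * E ^ 2 / n / 2 - q h ω * E =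
          Real.exp (-κ) / (2 * n) * (n * q h ω - Real.exp κ * E) ^ 2 := by
        have h3 : Real.exp (-κ) = (Real.exp κ)⁻¹ := Real.exp_neg κ
        rw [h3]
        field_simp
        ring
      have h4 : 0 ≤ Real.exp (-κ) / (2 * n) * (n * q h ω - Real.exp κ * E) ^ 2 := by positivity
      linarith
    refine (Finset.sum_le_sum fun ω _ => pt ω).trans ?_
    rw [Finset.sum_add_distrib, ← Finset.sum_div, ← Finset.sum_mul, ← Finset.mul_sum,
      ← Finset.sum_div, ← Finset.sum_div, ← Finset.mul_sum]
    have h5 := mul_le_mul_of_nonneg_right (hκ h) (Real.exp_pos (-κ)).le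
    rw [← Real.exp_add, show 2 * κ + -κ = κ by ring] at h5
    have h6 : Real.exp κ / 2 * (1 + (∑ ω, Real.exp (2 * F ε ω)) / n) =
      Real.exp κ / 2 + Real.exp κ * (∑ ω, Real.exp (2 * F ε ω)) / n / 2 := by ring
    rw [h6]
    linarith
  have rad : ∀ ω, ∑ ε : Fin m → Bool, Real.exp (2 * F ε ω) ≤
      2 ^ m * Real.exp (2 * c ^ 2 * m) := by
    intro ω
    simp only [F, Finset.mul_sum, Real.exp_sum]
    rw [sum_prod_apply fun i e => Real.exp (2 * (sgn e * (c * g ω (s i))))]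
    have : ∀ i ∈ Finset.univ, ∑ e, Real.exp (2 * (sgn e * (c * g ω (s i)))) ≤
        2 * Real.exp (2 * c ^ 2) := by
      intro i _
      have h1 := Real.cosh_le_exp_half_sq (2 * (c * g ω (s i)))
      have h2 : Real.exp ((2 * (c * g ω (s i))) ^ 2 / 2) ≤ Real.exp (2 * c ^ 2) := by
        refine Real.exp_le_exp.2 ?_
        have := (sq_le_one_iff_abs_le_one _).2 (hg ω (s i))
        nlinarith [sq_nonneg c]
      rw [Real.cosh_eq] at h1
      have h3 := sum_sgn fun e => Real.exp (2 * (e * (c * g ω (s i))))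
      rw [one_mul, neg_one_mul, mul_neg] at h3
      rw [h3]
      linarith
    refine (Finset.prod_le_prod (fun i _ => Finset.sum_nonneg fun _ _ => (Real.exp_pos _).le)
      this).trans ?_
    rw [Finset.prod_const, Finset.card_univ, Fintype.card_fin, mul_pow, ← Real.exp_nat_mul]
    apply le_of_eq; ring_nf
  refine (Finset.sum_le_sum fun ε _ => step ε).trans ?_
  rw [← Finset.mul_sum, Finset.sum_add_distrib, ← Finset.sum_div, Finset.sum_comm]
  have h7 : (∑ ω, ∑ ε : Fin m → Bool, Real.exp (2 * F ε ω)) / n ≤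
      2 ^ m * Real.exp (2 * c ^ 2 * m) := by
    rw [div_le_iff₀ hn]
    refine (Finset.sum_le_sum fun ω _ => rad ω).trans ?_
    rw [Finset.sum_const, Finset.card_univ, nsmul_eq_mul, mul_comm]
  have h8 : ∑ _ε : Fin m → Bool, (1 : ℝ) ≤ 2 ^ m * Real.exp (2 * c ^ 2 * m) := by
    simp
    positivity
  rw [Real.exp_add]
  have := mul_le_mul_of_nonneg_left (add_le_add h8 h7) (Real.exp_pos κ).le
  linarith

/-- Symmetrization of exponential moments. -/
theorem sum_exp_iSup_symm {Y : Type*} [Fintype Y] {μ : Y → ℝ} (hμ0 : ∀ y, 0 ≤ μ y)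
    (hμ1 : ∑ y, μ y = 1) (F : H → Y → ℝ) (m : ℕ) :
    ∑ S : Fin m → Y, (∏ i, μ (S i)) * Real.exp (⨆ h, (m * ∑ y, μ y * F h y - ∑ i, F h (S i))) ≤
      ∑ S : Fin m → Y, (∏ i, μ (S i)) *
        ((∑ ε : Fin m → Bool, Real.exp (⨆ h, ∑ i, sgn (ε i) * (2 * F h (S i)))) / 2 ^ m) := by
  have hM0 : ∀ S : Fin m → Y, 0 ≤ ∏ i, μ (S i) := fun S => Finset.prod_nonneg fun i _ => hμ0 _
  have hM1 : ∑ S : Fin m → Y, ∏ i, μ (S i) = 1 :=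
    sum_prod_apply_eq_one (q := fun _ => μ) fun _ => hμ1
  -- Ghost sample: the expectation is an average over an independent copy `S'`.
  have jensen : ∀ S : Fin m → Y, Real.exp (⨆ h, (m * ∑ y, μ y * F h y - ∑ i, F h (S i))) ≤
      ∑ S' : Fin m → Y, (∏ i, μ (S' i)) * Real.exp (⨆ h, ∑ i, (F h (S' i) - F h (S i))) := by
    intro S
    obtain ⟨h, e⟩ := exists_eq_ciSup_of_finite
      (f := fun h => m * ∑ y, μ y * F h y - ∑ i, F h (S i))
    rw [← e]
    have h1 : m * ∑ y, μ y * F h y - ∑ i, F h (S i) =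
        ∑ S' : Fin m → Y, (∏ i, μ (S' i)) * ∑ i, (F h (S' i) - F h (S i)) := by
      simp_rw [Finset.sum_sub_distrib, mul_sub]
      rw [Finset.sum_sub_distrib, ← Finset.sum_mul, hM1, one_mul]
      congr 1
      simp_rw [Finset.mul_sum]
      rw [Finset.sum_comm]
      have : ∀ i : Fin m, ∑ S' : Fin m → Y, (∏ j, μ (S' j)) * F h (S' i) = ∑ y, μ y * F h y :=
        fun i => sum_prod_mul_apply (q := fun _ => μ) (fun _ => hμ1) i (F h)
      simp_rw [this]
      simp [Finset.mul_sum]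
    have h2 := convexOn_exp.map_sum_le (t := Finset.univ)
      (w := fun S' : Fin m → Y => ∏ i, μ (S' i))
      (p := fun S' => ∑ i, (F h (S' i) - F h (S i)))
      (fun S' _ => hM0 S') hM1 fun _ _ => Set.mem_univ _
    simp only [smul_eq_mul] at h2
    rw [h1]
    refine h2.trans (Finset.sum_le_sum fun S' _ => mul_le_mul_of_nonneg_left ?_ (hM0 S'))
    exact Real.exp_le_exp.2 (le_iSup_finite (fun h => ∑ i, (F h (S' i) - F h (S i))) h)
  set Z : (Fin m → ℝ) → (Fin m → Y) → (Fin m → Y) → ℝ := fun σ S S' =>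
    Real.exp (⨆ h, ∑ i, σ i * (F h (S' i) - F h (S i)))
  set T : ℝ := ∑ S : Fin m → Y, ∑ S' : Fin m → Y, (∏ i, μ (S i)) * (∏ i, μ (S' i)) *
    Z (fun _ => 1) S S'
  -- Exchanging `S i` with `S' i` wherever `ε i` is false preserves the product weights.
  have swap : ∀ ε : Fin m → Bool, ∑ S : Fin m → Y, ∑ S' : Fin m → Y,
      (∏ i, μ (S i)) * (∏ i, μ (S' i)) * Z (fun i => sgn (ε i)) S S' = T := by
    intro ε
    have pairs : ∀ f : (Fin m → Y) → (Fin m → Y) → ℝ, ∑ S, ∑ S', f S S' =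
        ∑ s : Fin m → Y × Y, f (fun i => (s i).1) fun i => (s i).2 := fun f => by
      rw [← Fintype.sum_prod_type', ← (Equiv.arrowProdEquivProdArrow (Fin m) (fun _ => Y)
        (fun _ => Y)).sum_comp]
      rfl
    simp only [T]
    rw [pairs, pairs, ← (Equiv.piCongrRight fun i : Fin m =>
      if ε i then Equiv.refl (Y × Y) else Equiv.prodComm Y Y).sum_comp]
    refine Finset.sum_congr rfl fun s _ => ?_
    rw [← Finset.prod_mul_distrib, ← Finset.prod_mul_distrib]
    congr 1
    · refine Finset.prod_congr rfl fun i _ => ?_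
      by_cases h : ε i <;> simp [h, mul_comm]
    · simp only [Z]
      congr 2
      funext h
      refine Finset.sum_congr rfl fun i _ => ?_
      by_cases h : ε i <;> simp [h, sgn]
  -- Decoupling by `e^(u+v) ≤ (e^(2u) + e^(2v)) / 2`, the origin of the factor `2`.
  have bound : ∀ (ε : Fin m → Bool) (S S' : Fin m → Y), Z (fun i => sgn (ε i)) S S' ≤
      (Real.exp (⨆ h, ∑ i, sgn (ε i) * (2 * F h (S' i))) +
        Real.exp (⨆ h, ∑ i, sgn (!ε i) * (2 * F h (S i)))) / 2 := by
    intro ε S S'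
    simp only [Z]
    obtain ⟨h, e⟩ := exists_eq_ciSup_of_finite
      (f := fun h => ∑ i, sgn (ε i) * (F h (S' i) - F h (S i)))
    rw [← e]
    have a1 := Real.exp_le_exp.2 (le_iSup_finite
      (fun h => ∑ i, sgn (ε i) * (2 * F h (S' i))) h)
    have a2 := Real.exp_le_exp.2 (le_iSup_finite
      (fun h => ∑ i, sgn (!ε i) * (2 * F h (S i))) h)
    set u := ∑ i, sgn (ε i) * F h (S' i)
    set v := ∑ i, sgn (!ε i) * F h (S i)
    have hu : ∑ i, sgn (ε i) * (2 * F h (S' i)) = 2 * u := by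
      simp only [u, Finset.mul_sum]; exact Finset.sum_congr rfl fun i _ => by ring
    have hv : ∑ i, sgn (!ε i) * (2 * F h (S i)) = 2 * v := by
      simp only [v, Finset.mul_sum]; exact Finset.sum_congr rfl fun i _ => by ring
    have huv : ∑ i, sgn (ε i) * (F h (S' i) - F h (S i)) = u + v := by
      simp only [u, v, ← Finset.sum_add_distrib, sgn_not]
      exact Finset.sum_congr rfl fun i _ => by ring
    simp only [hu, hv] at a1 a2
    simp only [huv]
    rw [Real.exp_add]
    rw [two_mul, Real.exp_add] at a1 a2
    nlinarith [sq_nonneg (Real.exp u - Real.exp v)]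
  have hT : T ≤ ∑ S : Fin m → Y, (∏ i, μ (S i)) *
        ((∑ ε : Fin m → Bool, Real.exp (⨆ h, ∑ i, sgn (ε i) * (2 * F h (S i)))) / 2 ^ m) := by
    set R : (Fin m → Y) → (Fin m → Bool) → ℝ := fun S ε =>
      Real.exp (⨆ h, ∑ i, sgn (ε i) * (2 * F h (S i)))
    have hneg : ∀ S : Fin m → Y, ∑ ε : Fin m → Bool, R S (fun i => !(ε i)) = ∑ ε, R S ε := fun S =>
      (Equiv.piCongrRight fun _ : Fin m => Equiv.boolNot).sum_comp (R S)
    have h1 : (2 : ℝ) ^ m * T ≤ ∑ S : Fin m → Y, (∏ i, μ (S i)) * ∑ ε, R S ε := by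
      calc (2 : ℝ) ^ m * T = ∑ _ε : Fin m → Bool, T := by simp
        _ = ∑ ε : Fin m → Bool, ∑ S : Fin m → Y, ∑ S' : Fin m → Y,
            (∏ i, μ (S i)) * (∏ i, μ (S' i)) * Z (fun i => sgn (ε i)) S S' :=
          Finset.sum_congr rfl fun ε _ => (swap ε).symm
        _ ≤ ∑ ε : Fin m → Bool, ∑ S : Fin m → Y, ∑ S' : Fin m → Y,
            (∏ i, μ (S i)) * (∏ i, μ (S' i)) * ((R S' ε + R S fun i => !ε i) / 2) :=
          Finset.sum_le_sum fun ε _ => Finset.sum_le_sum fun S _ => Finset.sum_le_sum fun S' _ =>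
            mul_le_mul_of_nonneg_left (bound ε S S') (mul_nonneg (hM0 S) (hM0 S'))
        _ = ∑ ε : Fin m → Bool, ((∑ S : Fin m → Y, (∏ i, μ (S i)) * R S ε) +
            ∑ S : Fin m → Y, (∏ i, μ (S i)) * R S fun i => !ε i) / 2 := by
          refine Finset.sum_congr rfl fun ε _ => ?_
          have e : ∀ S S' : Fin m → Y, (∏ i, μ (S i)) * (∏ i, μ (S' i)) *
              ((R S' ε + R S fun i => !ε i) / 2) =
              (∏ i, μ (S i)) * ((∏ i, μ (S' i)) * R S' ε) / 2 +
              ((∏ i, μ (S i)) * R S fun i => !ε i) / 2 * (∏ i, μ (S' i)) := fun S S' => by ring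
          simp_rw [e, Finset.sum_add_distrib, ← Finset.sum_div, ← Finset.mul_sum, hM1, mul_one,
            ← Finset.sum_div, ← Finset.sum_mul, hM1, one_mul]
          ring
        _ = _ := by
          rw [← Finset.sum_div, Finset.sum_add_distrib, Finset.sum_comm,
            Finset.sum_comm (f := fun (ε : Fin m → Bool) (S : Fin m → Y) =>
              (∏ i, μ (S i)) * R S fun i => !ε i)]
          simp_rw [← Finset.mul_sum, hneg]
          ring
    have h2 : ∑ S : Fin m → Y, (∏ i, μ (S i)) * ((∑ ε, R S ε) / 2 ^ m) =
        (∑ S : Fin m → Y, (∏ i, μ (S i)) * ∑ ε, R S ε) / 2 ^ m := by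
      rw [Finset.sum_div]; exact Finset.sum_congr rfl fun S _ => by ring
    rw [h2, le_div_iff₀ (by positivity)]
    linarith
  refine le_trans (Finset.sum_le_sum fun S _ =>
    mul_le_mul_of_nonneg_left (jensen S) (hM0 S)) (le_trans (le_of_eq ?_) hT)
  simp only [T, Z, one_mul, Finset.mul_sum, mul_assoc]

end Suprema

/-! ### Deviation inequality for ramps of mixtures. -/

/-- The piecewise linear ramp from `0` at `1/4` to `1` at `3/4`. -/
def ramp (p : ℝ) : ℝ := max 0 (min 1 (2 * p - 1 / 2))

theorem ramp_nonneg (p : ℝ) : 0 ≤ ramp p := le_max_left _ _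

theorem ramp_le_one (p : ℝ) : ramp p ≤ 1 := max_le zero_le_one (min_le_left _ _)

theorem ramp_eq_one {p : ℝ} (hp : 3 / 4 ≤ p) : ramp p = 1 := by
  rw [ramp, min_eq_left (by linarith), max_eq_right zero_le_one]

theorem ramp_eq_zero {p : ℝ} (hp : p ≤ 1 / 4) : ramp p = 0 :=
  max_eq_left ((min_le_right _ _).trans (by linarith))

theorem ramp_mono : Monotone ramp := fun x y h => by unfold ramp; gcongr

theorem ramp_sub_le {x y : ℝ} (h : x ≤ y) : ramp y - ramp x ≤ 2 * (y - x) := by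
  unfold ramp
  rcases max_cases (0 : ℝ) (min 1 (2 * x - 1 / 2)) with h1 | h1 <;>
  rcases max_cases (0 : ℝ) (min 1 (2 * y - 1 / 2)) with h2 | h2 <;>
  rcases min_cases (1 : ℝ) (2 * x - 1 / 2) with h3 | h3 <;>
  rcases min_cases (1 : ℝ) (2 * y - 1 / 2) with h4 | h4 <;> linarith

/-- Uniform deviation bound for ramps of mixtures over a finite sample space. -/
theorem sum_prod_deviation_le {H Ω Y : Type*} [Fintype Ω] [Fintype Y] {μ : Y → ℝ}
    (hμ0 : ∀ y, 0 ≤ μ y) (hμ1 : ∑ y, μ y = 1) (q : H → Ω → ℝ) (g : Ω → Y → ℝ)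
    (hq0 : ∀ h ω, 0 ≤ q h ω) (hq1 : ∀ h, ∑ ω, q h ω = 1) (hg0 : ∀ ω y, 0 ≤ g ω y)
    (hg : ∀ ω y, g ω y ≤ 1) {κ : ℝ}
    (hκ : ∀ h, Fintype.card Ω * ∑ ω, q h ω ^ 2 ≤ Real.exp (2 * κ)) {m : ℕ} {lam : ℝ}
    (hlam : 0 ≤ lam) (t : ℝ) (Bad : Finset (Fin m → Y))
    (hBad : ∀ S ∈ Bad, ∃ h, t ≤ m * ∑ y, μ y * ramp (∑ ω, q h ω * g ω y) -
      ∑ i, ramp (∑ ω, q h ω * g ω (S i))) :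
    ∑ S ∈ Bad, ∏ i, μ (S i) ≤ Real.exp (κ + 32 * lam ^ 2 * m - lam * t) := by
  rcases Bad.eq_empty_or_nonempty with rfl | hne
  · simpa using (Real.exp_pos _).le
  have : Nonempty H := (hBad _ hne.choose_spec).nonempty
  -- One witness per bad sample leaves a finite index set, on which suprema are attained.
  choose! w hw using hBad
  let H' := {S // S ∈ Bad}
  have : Nonempty H' := hne.to_subtype
  have hM0 : ∀ S : Fin m → Y, 0 ≤ ∏ i, μ (S i) := fun S => Finset.prod_nonneg fun i _ => hμ0 _
  have hM1 : ∑ S : Fin m → Y, ∏ i, μ (S i) = 1 :=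
    sum_prod_apply_eq_one (q := fun _ => μ) fun _ => hμ1
  set p : H' → Y → ℝ := fun h y => ∑ ω, q (w h) ω * g ω y
  have hp : ∀ h y, 0 ≤ p h y := fun h y =>
    Finset.sum_nonneg fun ω _ => mul_nonneg (hq0 _ _) (hg0 _ _)
  have sym := sum_exp_iSup_symm hμ0 hμ1 (fun (h : H') y => lam * ramp (p h y)) m
  have rad : ∀ S : Fin m → Y,
      (∑ ε : Fin m → Bool, Real.exp (⨆ h : H', ∑ i, sgn (ε i) *
        (2 * (lam * ramp (p h (S i)))))) / 2 ^ m ≤ Real.exp (κ + 32 * lam ^ 2 * m) := by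
    intro S
    rw [div_le_iff₀ (by positivity)]
    -- `2 * lam * ramp` is `4 * lam`-Lipschitz, and `2 * (4 * lam)² = 32 * lam²`.
    have c1 := exp_iSup_contract (H := H') (G := fun x => 2 * (lam * ramp x))
      (L := 4 * lam) (by simp [ramp_eq_zero]) (fun x y h => by
        have := ramp_mono h; dsimp only; gcongr)
      (fun x y h => by nlinarith [ramp_sub_le h]) m (fun _ => 0) (fun h i => p h (S i))
      fun h i => hp h _
    have c2 := sum_exp_iSup_mixture (H := H') (fun h => q (w h)) g (fun h => hq0 _)
      (fun h => hq1 _) (fun ω y => abs_le.2 ⟨by linarith [hg0 ω y], hg ω y⟩) (fun h => hκ _)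
      (4 * lam) S
    simp only [zero_add] at c1
    refine (c1.trans c2).trans (le_of_eq ?_)
    rw [mul_comm]
    congr 2
    ring
  have h1 : ∑ S : Fin m → Y, (∏ i, μ (S i)) * Real.exp (⨆ h : H',
      (m * ∑ y, μ y * (lam * ramp (p h y)) - ∑ i, lam * ramp (p h (S i)))) ≤
      Real.exp (κ + 32 * lam ^ 2 * m) := by
    refine sym.trans ((Finset.sum_le_sum fun S _ =>
      mul_le_mul_of_nonneg_left (rad S) (hM0 S)).trans ?_)
    rw [← Finset.sum_mul, hM1, one_mul]
  have h2 : ∀ S ∈ Bad, (∏ i, μ (S i)) * Real.exp (lam * t) ≤ (∏ i, μ (S i)) *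
      Real.exp (⨆ h : H',
        (m * ∑ y, μ y * (lam * ramp (p h y)) - ∑ i, lam * ramp (p h (S i)))) := by
    intro S hS
    refine mul_le_mul_of_nonneg_left (Real.exp_le_exp.2 ?_) (hM0 S)
    refine le_trans ?_ (le_iSup_finite (fun h : H' =>
      (m * ∑ y, μ y * (lam * ramp (p h y)) - ∑ i, lam * ramp (p h (S i)))) ⟨S, hS⟩)
    have h3 := mul_le_mul_of_nonneg_left (hw S hS) hlam
    refine h3.trans (le_of_eq ?_)
    simp only [p, Finset.mul_sum, mul_sub]
    congr 1
    exact Finset.sum_congr rfl fun y _ => by ring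
  have h3 : (∑ S ∈ Bad, ∏ i, μ (S i)) * Real.exp (lam * t) ≤ Real.exp (κ + 32 * lam ^ 2 * m) := by
    rw [Finset.sum_mul]
    refine (Finset.sum_le_sum h2).trans (le_trans ?_ h1)
    exact Finset.sum_le_sum_of_subset_of_nonneg (Finset.subset_univ _) fun S _ _ =>
      mul_nonneg (hM0 S) (Real.exp_pos _).le
  rw [Real.exp_sub, le_div_iff₀ (Real.exp_pos _)]
  exact h3

/-! ### Toeplitz layers as combinations of shifts; homogeneity of the network. -/

section Layers

variable {h : ℕ}

/-- The left shift by `c`, filling with zeros. -/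
def shift (c : ℕ) (z : Fin h → ℝ) (i : Fin h) : ℝ := if hi : (i : ℕ) + c < h then z ⟨i + c, hi⟩ else 0

theorem toep_mulVec {k : ℕ} (v : Fin k → ℝ) (z : Fin h → ℝ) (i : Fin h) :
    (toep h v).mulVec z i = ∑ c, v c * shift c z i := by
  have e : ∀ c : Fin k, v c * shift c z i =
      ∑ j : Fin h, if (j : ℕ) = i + c then v c * z j else 0 := by
    intro c
    unfold shift
    split_ifs with hi
    · rw [Finset.sum_eq_single (⟨i + c, hi⟩ : Fin h)]
      · simp
      · intro j _ hj
        rw [if_neg]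
        rintro hj'
        exact hj (Fin.ext hj')
      · simp
    · rw [mul_zero, Finset.sum_eq_zero]
      intro j _
      rw [if_neg]
      have := j.2
      omega
  simp_rw [e]
  rw [Finset.sum_comm]
  simp only [Matrix.mulVec, dotProduct, toep, Matrix.of_apply]
  refine Finset.sum_congr rfl fun j _ => ?_
  split_ifs with hij
  · rw [Finset.sum_eq_single (⟨_, hij.2⟩ : Fin k)]
    · rw [if_pos]; simp only; omega
    · intro c _ hc
      rw [if_neg]
      intro hj
      apply hc
      ext
      simp only
      omega
    · simp
  · rw [zero_mul, Finset.sum_eq_zero]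
    intro c _
    rw [if_neg]
    intro hj
    have := c.2
    omega

theorem sum_shift_sq_le (c : ℕ) (z : Fin h → ℝ) : ∑ i, shift c z i ^ 2 ≤ ∑ i, z i ^ 2 := by
  classical
  have e : ∀ i, shift c z i ^ 2 = ∑ j : Fin h, if (j : ℕ) = i + c then z j ^ 2 else 0 := by
    intro i
    unfold shift
    split_ifs with hi
    · rw [Finset.sum_eq_single (⟨i + c, hi⟩ : Fin h)]
      · simp
      · intro j _ hj
        rw [if_neg]
        rintro hj'
        exact hj (Fin.ext hj')
      · simp
    · rw [zero_pow two_ne_zero, eq_comm, Finset.sum_eq_zero]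
      intro j _
      rw [if_neg]
      have := j.2
      omega
  simp_rw [e]
  rw [Finset.sum_comm]
  refine Finset.sum_le_sum fun j _ => ?_
  by_cases hj : ∃ i : Fin h, (j : ℕ) = i + c
  · obtain ⟨i, hi⟩ := hj
    rw [Finset.sum_eq_single i]
    · simp [hi]
    · intro i' _ hi'
      rw [if_neg]
      intro hc
      apply hi'
      ext
      omega
    · simp
  · rw [Finset.sum_eq_zero]
    · positivity
    · intro i _
      rw [if_neg fun hc => hj ⟨i, hc⟩]

/-- Shifts are `ℓ²` contractions; Cauchy–Schwarz with the weights `|v c|` combines them. -/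
theorem sum_toep_mulVec_sq_le {k : ℕ} (v : Fin k → ℝ) (z : Fin h → ℝ) :
    ∑ i, (toep h v).mulVec z i ^ 2 ≤ (∑ c, |v c|) ^ 2 * ∑ i, z i ^ 2 := by
  have pt : ∀ i, (toep h v).mulVec z i ^ 2 ≤ (∑ c, |v c|) * ∑ c, |v c| * shift c z i ^ 2 := by
    intro i
    rw [toep_mulVec]
    refine Finset.sum_sq_le_sum_mul_sum_of_sq_le_mul _ (fun c _ => abs_nonneg _)
      (fun c _ => by positivity) fun c _ => le_of_eq ?_
    rw [mul_pow, ← sq_abs (v c)]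
    ring
  refine (Finset.sum_le_sum fun i _ => pt i).trans ?_
  rw [← Finset.mul_sum, Finset.sum_comm, sq, mul_assoc]
  refine mul_le_mul_of_nonneg_left ?_ (Finset.sum_nonneg fun c _ => abs_nonneg _)
  rw [Finset.sum_mul]
  refine Finset.sum_le_sum fun c _ => ?_
  rw [← Finset.mul_sum]
  exact mul_le_mul_of_nonneg_left (sum_shift_sq_le _ _) (abs_nonneg _)

theorem relu_sq_le (x : ℝ) : max 0 x ^ 2 ≤ x ^ 2 := by
  rcases max_cases 0 x with h | h <;> rw [h.1]
  simpa using sq_nonneg x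

theorem relu_sub_sq_le (x y : ℝ) : (max 0 x - max 0 y) ^ 2 ≤ (x - y) ^ 2 := by
  rw [sq_le_sq, max_comm 0 x, max_comm 0 y]
  exact abs_max_sub_max_le_abs x y 0

theorem sum_network_sq_le (d : ℕ) {k : ℕ} (w : Fin d → Fin k → ℝ) (x : Fin h → ℝ) :
    ∑ i, network d (fun l => toep h (w l)) x i ^ 2 ≤
      (∏ l, ∑ c, |w l c|) ^ 2 * ∑ i, x i ^ 2 := by
  match d with
  | 0 => simp [network]
  | 1 => simpa [network] using sum_toep_mulVec_sq_le (w 0) x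
  | d + 2 =>
    have ih := sum_network_sq_le (d + 1) (fun l => w l.castSucc) x
    rw [network]
    refine (sum_toep_mulVec_sq_le _ _).trans ?_
    rw [Fin.prod_univ_castSucc, mul_comm (∏ i : Fin (d + 1), _), mul_pow, mul_assoc]
    refine mul_le_mul_of_nonneg_left (le_trans (Finset.sum_le_sum fun i _ => relu_sq_le _) ih)
      (sq_nonneg _)

/-- ReLU commutes with nonnegative scaling, so the factors pass through every layer. This permits
the `ℓ¹` normalization of the kernels. -/
theorem network_smul (d : ℕ) (a : Fin d → ℝ) (ha : ∀ l, 0 ≤ a l)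
    (W : Fin d → Matrix (Fin h) (Fin h) ℝ) (x : Fin h → ℝ) :
    network d (fun l => a l • W l) x = (∏ l, a l) • network d W x := by
  match d with
  | 0 => simp [network]
  | 1 => simp [network, Matrix.smul_mulVec]
  | d + 2 =>
    have ih := network_smul (d + 1) (fun l => a l.castSucc) (fun l => ha _)
      (fun l => W l.castSucc) x
    have hp : 0 ≤ ∏ l : Fin (d + 1), a l.castSucc := Finset.prod_nonneg fun l _ => ha _
    rw [network, ih, network, Fin.prod_univ_castSucc a]
    have : (fun i => max 0 (((∏ l : Fin (d + 1), a l.castSucc) •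
        network (d + 1) (fun l => W l.castSucc) x) i)) =
        (∏ l : Fin (d + 1), a l.castSucc) •
          fun i => max 0 (network (d + 1) (fun l => W l.castSucc) x i) := by
      funext i
      simp only [Pi.smul_apply, smul_eq_mul]
      rw [mul_max_of_nonneg _ _ hp, mul_zero]
    rw [this, Matrix.smul_mulVec, Matrix.mulVec_smul, smul_smul, mul_comm]

theorem toep_smul {k : ℕ} (a : ℝ) (v : Fin k → ℝ) : toep h (a • v) = a • toep h v := by
  ext i j
  simp [toep]

theorem continuous_network (d : ℕ) (W : Fin d → Matrix (Fin h) (Fin h) ℝ) :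
    Continuous (network d W) := by
  match d with
  | 0 => exact continuous_id
  | 1 => simp only [network]; fun_prop
  | d + 2 =>
    have ih := continuous_network (d + 1) fun l => W l.castSucc
    simp only [network]
    fun_prop

theorem continuous_convNet {d k K : ℕ} (hK : K ≤ h) (w : Fin d → Fin k → ℝ) :
    Continuous (convNet hK w) := by
  have := continuous_network d fun l => toep h (w l)
  unfold convNet
  fun_prop

end Layers

/-! ### Maurey sampling of the kernels. -/

section Sampling

variable {k : ℕ}

/-- The signed coordinate vector `± e_c`. -/
def atom (a : Fin k × Bool) (c : Fin k) : ℝ := if c = a.1 then sgn a.2 else 0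

/-- The sampling weights of the signed coordinate vectors, of mean `v` if `‖v‖₁ = 1`. -/
def atomWeight (v : Fin k → ℝ) (a : Fin k × Bool) : ℝ := (|v a.1| + sgn a.2 * v a.1) / 2

theorem atomWeight_nonneg (v : Fin k → ℝ) (a : Fin k × Bool) : 0 ≤ atomWeight v a := by
  rcases a with ⟨c, b⟩
  have := neg_abs_le (v c)
  have := le_abs_self (v c)
  cases b <;> simp [atomWeight, sgn] <;> linarith

theorem sum_atomWeight (v : Fin k → ℝ) : ∑ a, atomWeight v a = ∑ c, |v c| := by
  rw [Fintype.sum_prod_type]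
  refine Finset.sum_congr rfl fun c _ => ?_
  simp [atomWeight, sgn]
  ring

/-- The two weights at `c` are the positive and negative parts of `v c`; one of them vanishes, so
there is no cross term. -/
theorem sum_atomWeight_sq (v : Fin k → ℝ) : ∑ a, atomWeight v a ^ 2 = ∑ c, v c ^ 2 := by
  rw [Fintype.sum_prod_type]
  refine Finset.sum_congr rfl fun c _ => ?_
  simp only [atomWeight, sgn, Fintype.sum_bool]
  norm_num
  nlinarith [sq_abs (v c)]

theorem sum_atomWeight_mul (v X : Fin k → ℝ) :
    ∑ a, atomWeight v a * (sgn a.2 * X a.1) = ∑ c, v c * X c := by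
  rw [Fintype.sum_prod_type]
  refine Finset.sum_congr rfl fun c _ => ?_
  simp [atomWeight, sgn]
  ring

/-- The average of a list of signed coordinate vectors. -/
def avgAtom {N : ℕ} (τ : Fin N → Fin k × Bool) (c : Fin k) : ℝ := (∑ t, atom (τ t) c) / N

theorem sum_avgAtom_mul {N : ℕ} (τ : Fin N → Fin k × Bool) (X : Fin k → ℝ) :
    ∑ c, avgAtom τ c * X c = ∑ t, sgn (τ t).2 * X (τ t).1 / N := by
  simp only [avgAtom, Finset.sum_div, Finset.sum_mul]
  rw [Finset.sum_comm]
  refine Finset.sum_congr rfl fun t _ => ?_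
  simp [atom, ite_div, mul_div_right_comm]

/-- Sampled kernels stay in the `ℓ¹` ball, so sampled hidden layers never exceed the norm of the
input. -/
theorem sum_abs_avgAtom_le {N : ℕ} (τ : Fin N → Fin k × Bool) : ∑ c, |avgAtom τ c| ≤ 1 := by
  have h1 : ∀ c, |avgAtom τ c| ≤ (∑ t, |atom (τ t) c|) / N := fun c => by
    rw [avgAtom, abs_div, Nat.abs_cast]
    exact div_le_div_of_nonneg_right (Finset.abs_sum_le_sum_abs _ _) (Nat.cast_nonneg _)
  refine (Finset.sum_le_sum fun c _ => h1 c).trans ?_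
  rw [← Finset.sum_div, Finset.sum_comm]
  have h2 : ∀ t, ∑ c, |atom (τ t) c| = 1 := fun t => by
    have h3 : ∀ b, |sgn b| = 1 := fun b => by cases b <;> simp [sgn]
    simp [atom, apply_ite abs, h3]
  simp_rw [h2]
  simpa using div_self_le_one (N : ℝ)

variable {h : ℕ}

/-- Bias-variance decomposition for one sampled layer. -/
theorem sum_sampled_layer_le {v : Fin k → ℝ} (hv : ∑ c, |v c| = 1) {N : ℕ} (hN : 0 < N)
    (z z' : Fin h → ℝ) :
    ∑ τ : Fin N → Fin k × Bool, (∏ t, atomWeight v (τ t)) *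
      ∑ i, ((toep h (avgAtom τ)).mulVec z i - (toep h v).mulVec z' i) ^ 2 ≤
        ∑ i, (z i - z' i) ^ 2 + (∑ i, z i ^ 2) / N := by
  have hN' : (0 : ℝ) < N := by exact_mod_cast hN
  have hq1 : ∑ a, atomWeight v a = 1 := by rw [sum_atomWeight, hv]
  have row : ∀ i, ∑ τ : Fin N → Fin k × Bool, (∏ t, atomWeight v (τ t)) *
      ((toep h (avgAtom τ)).mulVec z i - (toep h v).mulVec z' i) ^ 2 ≤
      (toep h v).mulVec (z - z') i ^ 2 + (∑ c, |v c| * shift c z i ^ 2) / N := by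
    intro i
    have e := sum_prod_mul_sq hq1 (fun a => sgn a.2 * (shift a.1 z i / N)) N
      (-(toep h v).mulVec z' i)
    rw [sum_atomWeight_mul v fun c => shift c z i / N] at e
    have e1 : ∑ c, v c * (shift c z i / N) = (toep h v).mulVec z i / N := by
      rw [toep_mulVec, Finset.sum_div]
      exact Finset.sum_congr rfl fun c _ => by ring
    have e2 : ∑ a, atomWeight v a * (sgn a.2 * (shift a.1 z i / N)) ^ 2 =
        (∑ c, |v c| * shift c z i ^ 2) / N ^ 2 := by
      rw [Fintype.sum_prod_type, Finset.sum_div]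
      refine Finset.sum_congr rfl fun c _ => ?_
      simp [atomWeight, sgn]
      ring
    have e3 : (toep h v).mulVec (z - z') i =
        -(toep h v).mulVec z' i + N * ((toep h v).mulVec z i / N) := by
      rw [Matrix.mulVec_sub, Pi.sub_apply]
      field_simp
      ring
    have e4 : ∀ τ : Fin N → Fin k × Bool, (toep h (avgAtom τ)).mulVec z i -
        (toep h v).mulVec z' i =
        -(toep h v).mulVec z' i + ∑ t, sgn (τ t).2 * (shift (τ t).1 z i / N) := fun τ => by
      rw [toep_mulVec, sum_avgAtom_mul τ fun c => shift c z i]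
      simp only [mul_div_assoc]
      ring
    simp_rw [e4]
    rw [e, e1, e2, e3]
    have : N * ((∑ c, |v c| * shift c z i ^ 2) / (N : ℝ) ^ 2) =
      (∑ c, |v c| * shift c z i ^ 2) / N := by field_simp
    rw [mul_sub, this]
    -- The variance is bounded by the second moment; the squared mean is dropped.
    have : 0 ≤ N * ((toep h v).mulVec z i / N) ^ 2 := by positivity
    linarith
  simp_rw [Finset.mul_sum]
  rw [Finset.sum_comm]
  refine (Finset.sum_le_sum fun i _ => row i).trans ?_
  rw [Finset.sum_add_distrib]
  refine add_le_add ?_ ?_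
  · simpa [hv] using sum_toep_mulVec_sq_le v (z - z')
  · rw [← Finset.sum_div]
    refine div_le_div_of_nonneg_right ?_ hN'.le
    rw [Finset.sum_comm]
    simp_rw [← Finset.mul_sum]
    refine (Finset.sum_le_sum fun (c : Fin k) _ =>
      mul_le_mul_of_nonneg_left (sum_shift_sq_le c z) (abs_nonneg (v c))).trans ?_
    rw [← Finset.sum_mul, hv, one_mul]

/-- Conditionally on the earlier layers, the last one passes on their squared error without growth
(ReLU is 1-Lipschitz, the mean matrix a contraction) and adds variance at most `‖x‖² / N`. Hence
errors add up over the layers instead of multiplying. -/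
theorem sum_sampled_network_le {N : ℕ} (hN : 0 < N) (d : ℕ) {w : Fin d → Fin k → ℝ}
    (hw : ∀ l, ∑ c, |w l c| = 1) (x : Fin h → ℝ) :
    ∑ ω : Fin d → Fin N → Fin k × Bool, (∏ l, ∏ t, atomWeight (w l) (ω l t)) *
      ∑ i, (network d (fun l => toep h (avgAtom (ω l))) x i -
        network d (fun l => toep h (w l)) x i) ^ 2 ≤ d * (∑ i, x i ^ 2) / N := by
  match d with
  | 0 => simp [network]
  | 1 =>
    rw [sum_prod_mul_snoc fun (l : Fin 1) (τ : Fin N → Fin k × Bool) =>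
      ∏ t, atomWeight (w l) (τ t)]
    simpa [network, Fin.snoc] using sum_sampled_layer_le (hw 0) hN x x
  | d + 2 =>
    have ih := sum_sampled_network_le hN (d + 1) (fun l => hw l.castSucc) x
    have hq0 : ∀ ω : Fin (d + 1) → Fin N → Fin k × Bool,
        0 ≤ ∏ l, ∏ t, atomWeight (w l.castSucc) (ω l t) := fun ω =>
      Finset.prod_nonneg fun l _ => Finset.prod_nonneg fun t _ => atomWeight_nonneg _ _
    have hq1 : ∑ ω : Fin (d + 1) → Fin N → Fin k × Bool,
        ∏ l, ∏ t, atomWeight (w l.castSucc) (ω l t) = 1 :=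
      sum_prod_apply_eq_one (q := fun (l : Fin (d + 1)) (τ : Fin N → Fin k × Bool) =>
        ∏ t, atomWeight (w l.castSucc) (τ t)) fun l =>
          sum_prod_apply_eq_one (q := fun _ : Fin N => atomWeight (w l.castSucc)) fun _ => by
            rw [sum_atomWeight, hw]
    rw [sum_prod_mul_snoc fun (l : Fin (d + 2)) (τ : Fin N → Fin k × Bool) =>
      ∏ t, atomWeight (w l) (τ t)]
    have layer : ∀ ω : Fin (d + 1) → Fin N → Fin k × Bool,
        ∑ τ : Fin N → Fin k × Bool, (∏ t, atomWeight (w (Fin.last (d + 1))) (τ t)) *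
          ∑ i, (network (d + 2) (fun l => toep h (avgAtom
            ((Fin.snoc ω τ : Fin (d + 2) → Fin N → Fin k × Bool) l))) x i -
            network (d + 2) (fun l => toep h (w l)) x i) ^ 2 ≤
        ∑ i, (network (d + 1) (fun l => toep h (avgAtom (ω l))) x i -
          network (d + 1) (fun l => toep h (w l.castSucc)) x i) ^ 2 + (∑ i, x i ^ 2) / N := by
      intro ω
      simp only [network, Fin.snoc_last, Fin.snoc_castSucc]
      refine (sum_sampled_layer_le (hw _) hN _ _).trans (add_le_add ?_ ?_)
      · exact Finset.sum_le_sum fun i _ => relu_sub_sq_le _ _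
      · refine div_le_div_of_nonneg_right ?_ (Nat.cast_nonneg _)
        refine (Finset.sum_le_sum fun i _ => relu_sq_le _).trans
          ((sum_network_sq_le _ _ _).trans ?_)
        refine mul_le_of_le_one_left (Finset.sum_nonneg fun i _ => sq_nonneg _) ?_
        have h0 : 0 ≤ ∏ l, ∑ c, |avgAtom (ω l) c| :=
          Finset.prod_nonneg fun l _ => Finset.sum_nonneg fun c _ => abs_nonneg _
        exact pow_le_one₀ h0 (Finset.prod_le_one
          (fun l _ => Finset.sum_nonneg fun c _ => abs_nonneg _)
          fun l _ => sum_abs_avgAtom_le _)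
    refine (Finset.sum_le_sum fun ω _ => mul_le_mul_of_nonneg_left (layer ω) (hq0 ω)).trans ?_
    simp_rw [mul_add, Finset.sum_add_distrib]
    rw [← Finset.sum_mul, hq1, one_mul]
    refine (add_le_add_left ih _).trans (le_of_eq ?_)
    push_cast
    ring

end Sampling

/-! ### Margin errors of the sampled network. -/

section Margins

variable {d h k K : ℕ}

/-- Both sides factor over layers and draws; each factor is `y ≤ exp y` with `y = 2 k ‖v_l‖₂²`. This
is the chi-square hypothesis of `sum_exp_iSup_mixture`. -/
theorem card_mul_sum_atomWeight_sq_le (N : ℕ) (v : Fin d → Fin k → ℝ) :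
    Fintype.card (Fin d → Fin N → Fin k × Bool) *
      ∑ ω : Fin d → Fin N → Fin k × Bool, (∏ l, ∏ t, atomWeight (v l) (ω l t)) ^ 2 ≤
      Real.exp (2 * (N * k * ∑ l, ∑ c, v l c ^ 2)) := by
  have e : ∑ ω : Fin d → Fin N → Fin k × Bool, (∏ l, ∏ t, atomWeight (v l) (ω l t)) ^ 2 =
      ∏ l, (∑ c, v l c ^ 2) ^ N := by
    simp_rw [← Finset.prod_pow]
    rw [sum_prod_apply fun l (τ : Fin N → Fin k × Bool) => ∏ t, atomWeight (v l) (τ t) ^ 2]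
    refine Finset.prod_congr rfl fun l _ => ?_
    rw [sum_prod_apply fun (_ : Fin N) a => atomWeight (v l) a ^ 2]
    simp [sum_atomWeight_sq]
  rw [e]
  have c : (Fintype.card (Fin d → Fin N → Fin k × Bool) : ℝ) = ∏ _l : Fin d, (k * 2 : ℝ) ^ N := by
    simp
  rw [c, ← Finset.prod_mul_distrib, Finset.mul_sum, Finset.mul_sum, Real.exp_sum]
  refine Finset.prod_le_prod (fun l _ => by positivity) fun l _ => ?_
  rw [← mul_pow]
  have h1 : (k : ℝ) * 2 * ∑ c, v l c ^ 2 ≤ Real.exp (k * 2 * ∑ c, v l c ^ 2) :=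
    (le_add_of_nonneg_right zero_le_one).trans (Real.add_one_le_exp _)
  refine (pow_le_pow_left₀ (by positivity) h1 N).trans (le_of_eq ?_)
  rw [← Real.exp_nat_mul]
  congr 1
  ring

theorem measurableSet_marginError {f : EuclideanSpace ℝ (Fin h) → Fin K → ℝ} (hf : Continuous f)
    (γ : ℝ) : MeasurableSet (marginError γ f) := by
  have e : marginError γ f = ⋃ y : Fin K, ⋃ j : Fin K, ⋃ _ : j ≠ y,
      {x | f x y ≤ γ + f x j} ×ˢ {y} := by
    ext ⟨x, y⟩
    simp [marginError, and_comm]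
  rw [e]
  refine MeasurableSet.iUnion fun y => MeasurableSet.iUnion fun j => MeasurableSet.iUnion fun _ =>
    (measurableSet_le ?_ ?_).prod (measurableSet_singleton y)
  · exact ((continuous_apply y).comp hf).measurable
  · exact (((continuous_apply j).comp hf).measurable).const_add γ

/-- The probability that the sampled network errs at margin `θ`. -/
def sampledError (hK : K ≤ h) (N : ℕ) (θ : ℝ) (v : Fin d → Fin k → ℝ)
    (z : EuclideanSpace ℝ (Fin h) × Fin K) : ℝ :=
  ∑ ω : Fin d → Fin N → Fin k × Bool, (∏ l, ∏ t, atomWeight (v l) (ω l t)) *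
    (marginError θ (convNet hK fun l => avgAtom (ω l))).indicator (fun _ => (1 : ℝ)) z

theorem sum_prod_atomWeight (N : ℕ) {v : Fin d → Fin k → ℝ} (hv : ∀ l, ∑ c, |v l c| = 1) :
    ∑ ω : Fin d → Fin N → Fin k × Bool, ∏ l, ∏ t, atomWeight (v l) (ω l t) = 1 :=
  sum_prod_apply_eq_one (q := fun (l : Fin d) (τ : Fin N → Fin k × Bool) =>
    ∏ t, atomWeight (v l) (τ t)) fun l =>
      sum_prod_apply_eq_one (q := fun _ : Fin N => atomWeight (v l)) fun _ => by
        rw [sum_atomWeight, hv]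

theorem prod_atomWeight_nonneg {N : ℕ} (v : Fin d → Fin k → ℝ) (ω : Fin d → Fin N → Fin k × Bool) :
    0 ≤ ∏ l, ∏ t, atomWeight (v l) (ω l t) :=
  Finset.prod_nonneg fun _ _ => Finset.prod_nonneg fun _ _ => atomWeight_nonneg _ _

/-- The sampled network is within `θ / 4` of the mean network except with probability `1 / 4`. -/
theorem sum_far_le (hK : K ≤ h) {N : ℕ} (hN : 0 < N) {B θ : ℝ} (hθ : 0 < θ)
    (hNθ : 64 * d * B ^ 2 ≤ N * θ ^ 2) {v : Fin d → Fin k → ℝ} (hv : ∀ l, ∑ c, |v l c| = 1)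
    {x : EuclideanSpace ℝ (Fin h)} (hx : ‖x‖ ≤ B) :
    ∑ ω : Fin d → Fin N → Fin k × Bool, (∏ l, ∏ t, atomWeight (v l) (ω l t)) *
      (if ∃ j, θ / 4 < |convNet hK (fun l => avgAtom (ω l)) x j - convNet hK v x j|
        then 1 else 0) ≤ 1 / 4 := by
  have hN' : (0 : ℝ) < N := by exact_mod_cast hN
  have hxs : ∑ i, x i ^ 2 ≤ B ^ 2 := by
    rw [← EuclideanSpace.real_norm_sq_eq]
    exact pow_le_pow_left₀ (norm_nonneg x) hx 2
  -- Chebyshev's inequality; `hNθ` then turns `16 / θ² * (d * B² / N)` into at most `1 / 4`.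
  have pt : ∀ ω : Fin d → Fin N → Fin k × Bool,
      (if ∃ j, θ / 4 < |convNet hK (fun l => avgAtom (ω l)) x j - convNet hK v x j|
        then (1 : ℝ) else 0) ≤ 16 / θ ^ 2 * ∑ i,
        (network d (fun l => toep h (avgAtom (ω l))) (fun i => x i) i -
          network d (fun l => toep h (v l)) (fun i => x i) i) ^ 2 := by
    intro ω
    split_ifs with hj
    · obtain ⟨j, hj⟩ := hj
      have h1 := Finset.single_le_sum (f := fun i =>
        (network d (fun l => toep h (avgAtom (ω l))) (fun i => x i) i -
          network d (fun l => toep h (v l)) (fun i => x i) i) ^ 2)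
        (fun i _ => sq_nonneg _) (Finset.mem_univ (Fin.castLE hK j))
      have h2 := pow_le_pow_left₀ (by positivity) hj.le 2
      rw [sq_abs] at h2
      simp only [convNet] at h2
      rw [div_mul_eq_mul_div, le_div_iff₀ (by positivity)]
      linarith
    · positivity
  have h3 := sum_sampled_network_le hN d hv fun i => x i
  refine (Finset.sum_le_sum fun ω _ =>
    mul_le_mul_of_nonneg_left (pt ω) (prod_atomWeight_nonneg v ω)).trans ?_
  simp_rw [mul_left_comm _ (16 / θ ^ 2)]
  rw [← Finset.mul_sum]
  refine (mul_le_mul_of_nonneg_left h3 (by positivity)).trans ?_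
  rw [div_mul_div_comm, div_le_iff₀ (by positivity)]
  have := mul_le_mul_of_nonneg_left hxs (Nat.cast_nonneg (α := ℝ) d)
  linarith

/-- If every output moves by at most `θ / 4`, a difference of two moves by at most `θ / 2`. The
value `3 / 4` is where `ramp` reaches `1`. -/
theorem le_sampledError (hK : K ≤ h) {N : ℕ} (hN : 0 < N) {B θ : ℝ} (hθ : 0 < θ)
    (hNθ : 64 * d * B ^ 2 ≤ N * θ ^ 2) {v : Fin d → Fin k → ℝ} (hv : ∀ l, ∑ c, |v l c| = 1)
    {z : EuclideanSpace ℝ (Fin h) × Fin K} (hx : ‖z.1‖ ≤ B)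
    (hz : z ∈ marginError 0 (convNet hK v)) : 3 / 4 ≤ sampledError hK N (θ / 2) v z := by
  have far := sum_far_le hK hN hθ hNθ hv hx
  have pt : ∀ ω : Fin d → Fin N → Fin k × Bool, 1 -
      (if ∃ j, θ / 4 < |convNet hK (fun l => avgAtom (ω l)) z.1 j - convNet hK v z.1 j|
        then (1 : ℝ) else 0) ≤
      (marginError (θ / 2) (convNet hK fun l => avgAtom (ω l))).indicator (fun _ => (1 : ℝ)) z := by
    intro ω
    split_ifs with hj
    · rw [sub_self]; exact Set.indicator_nonneg (fun _ _ => zero_le_one) _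
    · push Not at hj
      obtain ⟨j, hjy, hle⟩ := hz
      rw [Set.indicator_of_mem]
      · norm_num
      · have h1 := (abs_le.1 (hj j)).1
        have h2 := (abs_le.1 (hj z.2)).2
        exact ⟨j, hjy, by linarith⟩
  have := Finset.sum_le_sum fun ω (_ : ω ∈ Finset.univ) =>
    mul_le_mul_of_nonneg_left (pt ω) (prod_atomWeight_nonneg v ω)
  simp_rw [mul_sub, mul_one, Finset.sum_sub_distrib] at this
  rw [sum_prod_atomWeight N hv] at this
  unfold sampledError
  linarith

/-- An error at margin `θ / 2` off the `θ`-margin error set forces a move beyond `θ / 4`. The value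
`1 / 4` is where `ramp` leaves `0`. -/
theorem sampledError_le (hK : K ≤ h) {N : ℕ} (hN : 0 < N) {B θ : ℝ} (hθ : 0 < θ)
    (hNθ : 64 * d * B ^ 2 ≤ N * θ ^ 2) {v : Fin d → Fin k → ℝ} (hv : ∀ l, ∑ c, |v l c| = 1)
    {z : EuclideanSpace ℝ (Fin h) × Fin K} (hx : ‖z.1‖ ≤ B)
    (hz : z ∉ marginError θ (convNet hK v)) : sampledError hK N (θ / 2) v z ≤ 1 / 4 := by
  refine le_trans (Finset.sum_le_sum fun ω _ =>
    mul_le_mul_of_nonneg_left ?_ (prod_atomWeight_nonneg v ω)) (sum_far_le hK hN hθ hNθ hv hx)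
  split_ifs with hj
  · exact Set.indicator_le_self' (fun _ _ => zero_le_one) _
  · push Not at hj
    rw [Set.indicator_of_notMem]
    rintro ⟨j, hjy, hle⟩
    refine hz ⟨j, hjy, ?_⟩
    have h1 := (abs_le.1 (hj j)).2
    have h2 := (abs_le.1 (hj z.2)).1
    linarith

end Margins

/-! ### Deviation at one fixed scale, and trivial bounds on the losses. -/

section Deviation

variable {d h k K m : ℕ}

/-- Uniform deviation bound over the normalized kernels of bounded complexity. -/
theorem pi_deviation_le (hK : K ≤ h) (hd : 1 ≤ d) (hm : 1 ≤ m) {B : ℝ} (hB : 0 < B)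
    (D : Measure (EuclideanSpace ℝ (Fin h) × Fin K)) [IsProbabilityMeasure D]
    (hD : ∀ᵐ z ∂D, ‖z.1‖ ≤ B) {a n : ℕ} (ha : 1 ≤ a) {δ : ℝ} (hδ : 0 < δ) (hδ1 : δ ≤ 1) :
    Measure.pi (fun _ : Fin m => D) {S | (∀ i, ‖(S i).1‖ ≤ B) ∧ ∃ v : Fin d → Fin k → ℝ,
      (∀ l, ∑ c, |v l c| = 1) ∧ 64 * d * a ^ 2 * k * ∑ l, ∑ c, v l c ^ 2 ≤ (n : ℝ) ∧
      empMarginLoss S (B / a) (convNet hK v) + 12 * √((n + Real.log (1 / δ)) / m) <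
        marginLoss D 0 (convNet hK v)} ≤ ENNReal.ofReal δ := by
  classical
  have ha' : (0 : ℝ) < a := by exact_mod_cast ha
  have hm' : (0 : ℝ) < m := by exact_mod_cast hm
  have hθ : 0 < B / a := div_pos hB ha'
  set N : ℕ := 64 * d * a ^ 2 with hNdef
  have hN : 0 < N := by positivity
  have hNθ : 64 * d * B ^ 2 ≤ N * (B / a) ^ 2 := by
    rw [hNdef]; push_cast; apply le_of_eq; field_simp
  let Ω := Fin d → Fin N → Fin k × Bool
  let E : Ω → Set (EuclideanSpace ℝ (Fin h) × Fin K) := fun ω =>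
    marginError (B / a / 2) (convNet hK fun l => avgAtom (ω l))
  have hE : ∀ ω, MeasurableSet (E ω) := fun ω =>
    measurableSet_marginError (continuous_convNet hK _) _
  -- Only the pattern of errors of the finitely many sampled networks matters, so `D` can be pushed
  -- to a finite space.
  let r : EuclideanSpace ℝ (Fin h) × Fin K → Ω → Bool := fun z ω => decide (z ∈ E ω)
  have hr : Measurable r := measurable_pi_iff.2 fun ω => measurable_to_bool (by
    simpa [r, Set.preimage] using hE ω)
  let μ : (Ω → Bool) → ℝ := fun y => D.real (r ⁻¹' {y})
  have hμ0 : ∀ y, 0 ≤ μ y := fun y => measureReal_nonneg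
  have hint : ∀ F : (Ω → Bool) → ℝ, ∫ z, F (r z) ∂D = ∑ y, μ y * F y := by
    intro F
    have hF : Measurable F := measurable_of_finite F
    rw [← integral_map hr.aemeasurable hF.aestronglyMeasurable]
    have : IsProbabilityMeasure (D.map r) := Measure.isProbabilityMeasure_map hr.aemeasurable
    rw [integral_fintype (Integrable.of_finite)]
    refine Finset.sum_congr rfl fun y _ => ?_
    rw [map_measureReal_apply hr (measurableSet_singleton y), smul_eq_mul]
  have hμ1 : ∑ y, μ y = 1 := by simpa using (hint fun _ => 1).symm
  let g : Ω → (Ω → Bool) → ℝ := fun ω y => if y ω then 1 else 0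
  let H := {v : Fin d → Fin k → ℝ // (∀ l, ∑ c, |v l c| = 1) ∧
    64 * d * a ^ 2 * k * ∑ l, ∑ c, v l c ^ 2 ≤ (n : ℝ)}
  let q : H → Ω → ℝ := fun v ω => ∏ l, ∏ t, atomWeight (v.1 l) (ω l t)
  have hp : ∀ (v : H) z, ∑ ω, q v ω * g ω (r z) = sampledError hK N (B / a / 2) v.1 z := by
    intro v z
    refine Finset.sum_congr rfl fun ω _ => ?_
    simp [q, g, r, E, Set.indicator_apply]
  set x : ℝ := n + Real.log (1 / δ)
  have hx : 0 ≤ x := add_nonneg (Nat.cast_nonneg _)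
    (Real.log_nonneg (by rw [le_div_iff₀ hδ]; linarith))
  let T : ℝ := m * (12 * √(x / m))
  let Bad : Finset (Fin m → Ω → Bool) := Finset.univ.filter fun s => ∃ v : H,
    T ≤ m * ∑ y, μ y * ramp (∑ ω, q v ω * g ω y) - ∑ i, ramp (∑ ω, q v ω * g ω (s i))
  have key := sum_prod_deviation_le (κ := n) hμ0 hμ1 q g
    (fun v ω => prod_atomWeight_nonneg _ _) (fun v => sum_prod_atomWeight N v.2.1)
    (fun ω y => by simp only [g]; split_ifs <;> norm_num)
    (fun ω y => by simp only [g]; split_ifs <;> norm_num)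
    (fun v => (card_mul_sum_atomWeight_sq_le N v.1).trans (Real.exp_le_exp.2 (by
      have := v.2.2
      rw [hNdef]; push_cast; linarith)))
    (lam := √(x / m) / 6) (by positivity) T Bad fun S hS => (Finset.mem_filter.1 hS).2
  -- With `lam = √(x / m) / 6` the exponent is `n + (8/9) x - 2 x ≤ n - x = log δ`.
  have hexp : Real.exp (n + 32 * (√(x / m) / 6) ^ 2 * m - √(x / m) / 6 * T) ≤ δ := by
    have h1 : √(x / m) ^ 2 * m = x := by
      rw [Real.sq_sqrt (by positivity)]; field_simp
    have h2 : n + 32 * (√(x / m) / 6) ^ 2 * m - √(x / m) / 6 * T ≤ Real.log δ := by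
      have e : n + 32 * (√(x / m) / 6) ^ 2 * m - √(x / m) / 6 * T =
        n - 10 / 9 * (√(x / m) ^ 2 * m) := by simp only [T]; ring
      rw [e, h1]
      have : Real.log (1 / δ) = -Real.log δ := by rw [one_div, Real.log_inv]
      have : x = n - Real.log δ := by simp only [x]; rw [this]; ring
      linarith
    exact (Real.exp_le_exp.2 h2).trans (Real.exp_log hδ).le
  refine le_trans (measure_mono (t := ⋃ s ∈ Bad, Set.pi Set.univ fun i => r ⁻¹' {s i}) ?_)
    ((measure_biUnion_finset_le _ _).trans ?_)
  · rintro S ⟨hSB, v, hv1, hv2, hlt⟩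
    simp only [Set.mem_iUnion]
    refine ⟨fun i => r (S i), ?_, fun i _ => rfl⟩
    refine Finset.mem_filter.2 ⟨Finset.mem_univ _, ⟨v, hv1, hv2⟩, ?_⟩
    rw [← hint fun y => ramp (∑ ω, q ⟨v, hv1, hv2⟩ ω * g ω y)]
    simp only [hp]
    have hL : marginLoss D 0 (convNet hK v) ≤
        ∫ z, ramp (sampledError hK N (B / a / 2) v z) ∂D := by
      refine integral_mono_ae ?_ ?_ ?_
      · exact (integrable_const (1 : ℝ)).indicator
          (measurableSet_marginError (continuous_convNet hK v) 0)
      · have : (fun z => ramp (sampledError hK N (B / a / 2) v z)) =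
            (fun y => ramp (∑ ω, q ⟨v, hv1, hv2⟩ ω * g ω y)) ∘ r := by
          funext z; simp only [Function.comp, hp]
        rw [this]
        refine Integrable.of_bound (C := 1)
          ((measurable_of_finite _).comp hr).aestronglyMeasurable (Filter.Eventually.of_forall ?_)
        intro z
        rw [Real.norm_eq_abs, Function.comp, abs_of_nonneg (ramp_nonneg _)]
        exact ramp_le_one _
      · filter_upwards [hD] with z hz
        by_cases hz0 : z ∈ marginError 0 (convNet hK v)
        · rw [Set.indicator_of_mem hz0, ramp_eq_one (le_sampledError hK hN hθ hNθ hv1 hz hz0)]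
        · rw [Set.indicator_of_notMem hz0]; exact ramp_nonneg _
    have hR : ∑ i, ramp (sampledError hK N (B / a / 2) v (S i)) ≤
        m * empMarginLoss S (B / a) (convNet hK v) := by
      rw [empMarginLoss, mul_div_cancel₀ _ hm'.ne']
      refine Finset.sum_le_sum fun i _ => ?_
      by_cases hz0 : S i ∈ marginError (B / a) (convNet hK v)
      · rw [Set.indicator_of_mem hz0]; exact ramp_le_one _
      · rw [Set.indicator_of_notMem hz0,
          ramp_eq_zero (sampledError_le hK hN hθ hNθ hv1 (hSB i) hz0)]
    have := mul_le_mul_of_nonneg_left (hlt.le.trans hL) hm'.le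
    simp only [T]
    linarith
  · have e : ∀ s : Fin m → Ω → Bool,
        Measure.pi (fun _ : Fin m => D) (Set.pi Set.univ fun i => r ⁻¹' {s i}) =
          ENNReal.ofReal (∏ i, μ (s i)) := by
      intro s
      rw [Measure.pi_pi, ENNReal.ofReal_prod_of_nonneg fun i _ => hμ0 _]
      refine Finset.prod_congr rfl fun i _ => ?_
      exact (ofReal_measureReal).symm
    simp_rw [e]
    rw [← ENNReal.ofReal_sum_of_nonneg fun s _ => Finset.prod_nonneg fun i _ => hμ0 _]
    exact ENNReal.ofReal_le_ofReal (key.trans hexp)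

theorem convNet_smul (hK : K ≤ h) (a : Fin d → ℝ) (ha : ∀ l, 0 ≤ a l) (v : Fin d → Fin k → ℝ)
    (x : EuclideanSpace ℝ (Fin h)) (j : Fin K) :
    convNet hK (fun l => a l • v l) x j = (∏ l, a l) * convNet hK v x j := by
  simp only [convNet, toep_smul]
  rw [network_smul d a ha]
  rfl

theorem abs_convNet_le (hK : K ≤ h) (w : Fin d → Fin k → ℝ) {B : ℝ}
    {x : EuclideanSpace ℝ (Fin h)} (hx : ‖x‖ ≤ B) (j : Fin K) :
    |convNet hK w x j| ≤ (∏ l, ∑ c, |w l c|) * B := by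
  have hB : 0 ≤ B := (norm_nonneg x).trans hx
  have h0 : 0 ≤ ∏ l, ∑ c, |w l c| :=
    Finset.prod_nonneg fun l _ => Finset.sum_nonneg fun c _ => abs_nonneg _
  have h1 := sum_network_sq_le d w fun i => x i
  rw [← EuclideanSpace.real_norm_sq_eq] at h1
  have h2 := Finset.single_le_sum (f := fun i =>
    network d (fun l => toep h (w l)) (fun i => x i) i ^ 2)
    (fun i _ => sq_nonneg _) (Finset.mem_univ (Fin.castLE hK j))
  refine abs_le_of_sq_le_sq ?_ (by positivity)
  rw [mul_pow]
  refine (h2.trans h1).trans ?_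
  gcongr

/-- Outputs this small cannot beat a second label, which exists as `2 ≤ K`, by more than `γ`; the
bound is then trivial. -/
theorem empMarginLoss_eq_one (hm : 1 ≤ m) (h2K : 2 ≤ K) {γ : ℝ}
    {f : EuclideanSpace ℝ (Fin h) → Fin K → ℝ} {S : Fin m → EuclideanSpace ℝ (Fin h) × Fin K}
    (hf : ∀ i j, |f (S i).1 j| ≤ γ / 2) : empMarginLoss S γ f = 1 := by
  have : ∀ i, S i ∈ marginError γ f := by
    intro i
    have : Nontrivial (Fin K) := Fin.nontrivial_iff_two_le.2 h2K
    obtain ⟨j, hj⟩ := exists_ne (S i).2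
    have h1 := (abs_le.1 (hf i (S i).2)).2
    have h2 := (abs_le.1 (hf i j)).1
    exact ⟨j, hj, by linarith⟩
  simp only [empMarginLoss, Set.indicator_of_mem (this _)]
  simp
  omega

theorem marginLoss_le_one (D : Measure (EuclideanSpace ℝ (Fin h) × Fin K)) [IsProbabilityMeasure D]
    (γ : ℝ) (f : EuclideanSpace ℝ (Fin h) → Fin K → ℝ) : marginLoss D γ f ≤ 1 := by
  have h1 := integral_mono_of_nonneg (μ := D) (f := (marginError γ f).indicator fun _ => (1 : ℝ))
    (g := fun _ => 1) (Filter.Eventually.of_forall fun z =>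
      Set.indicator_nonneg (fun _ _ => zero_le_one) _) (integrable_const 1)
    (Filter.Eventually.of_forall fun z => Set.indicator_le_self' (fun _ _ => zero_le_one) _)
  simpa [marginLoss] using h1

theorem empMarginLoss_nonneg (S : Fin m → EuclideanSpace ℝ (Fin h) × Fin K)
    (γ : ℝ) (f : EuclideanSpace ℝ (Fin h) → Fin K → ℝ) : 0 ≤ empMarginLoss S γ f :=
  div_nonneg (Finset.sum_nonneg fun _ _ => Set.indicator_nonneg (fun _ _ => zero_le_one) _)
    (Nat.cast_nonneg _)

end Deviation

/-! ### Rescaling and the union bound over scales. -/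

section Generalization

variable {d h k K m : ℕ}

theorem one_le_mul_sum_sq {v : Fin k → ℝ} (hv : ∑ c, |v c| = 1) : 1 ≤ (k : ℝ) * ∑ c, v c ^ 2 := by
  have := sq_sum_le_card_mul_sum_sq (s := Finset.univ) (f := fun c => |v c|)
  simpa [hv] using this

theorem marginError_subset {f g : EuclideanSpace ℝ (Fin h) → Fin K → ℝ} {s γ θ : ℝ} (hs : 0 ≤ s)
    (hfg : ∀ x j, f x j = s * g x j) (hθ : s * θ ≤ γ) : marginError θ g ⊆ marginError γ f := by
  rintro z ⟨j, hj, hle⟩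
  refine ⟨j, hj, ?_⟩
  rw [hfg, hfg]
  nlinarith [mul_le_mul_of_nonneg_left hle hs]

theorem log_one_div_div_sq_le {m d δ : ℝ} (hm : 1 ≤ m) (hd : 1 ≤ d) (hδ : 0 < δ) (hδ1 : δ ≤ 1) :
    Real.log (1 / (δ / m ^ 2)) ≤ 2 * Real.log (m * d / δ) := by
  have e : 2 * Real.log (m * d / δ) = Real.log ((m * d / δ) ^ 2) := by
    rw [Real.log_pow]; norm_num
  rw [e]
  refine Real.log_le_log (by positivity) ?_
  have e2 : (m * d / δ) ^ 2 = 1 / (δ / m ^ 2) * (d ^ 2 / δ) := by field_simp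
  rw [e2]
  refine le_mul_of_one_le_right (by positivity) ?_
  rw [one_le_div hδ]
  exact hδ1.trans (one_le_pow₀ hd)

/-- The bound for all kernels from the bounds for normalized kernels on all scales. -/
theorem marginLoss_le_of_normalized (hK : K ≤ h) (hd : 1 ≤ d) (h2K : 2 ≤ K) (hm : 1 ≤ m)
    {B ρ : ℝ} (hB : 0 < B) (hρ : 1 ≤ ρ) (D : Measure (EuclideanSpace ℝ (Fin h) × Fin K))
    [IsProbabilityMeasure D] {γ δ : ℝ} (hγ : 0 < γ) (hδ : 0 < δ) (hδ1 : δ < 1)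
    {S : Fin m → EuclideanSpace ℝ (Fin h) × Fin K} (hS : ∀ i, ‖(S i).1‖ ≤ B)
    (good : ∀ a ∈ Finset.Icc 1 m, ∀ n ∈ Finset.Icc 1 m, ∀ v : Fin d → Fin k → ℝ,
      (∀ l, ∑ c, |v l c| = 1) → 64 * d * a ^ 2 * k * ∑ l, ∑ c, v l c ^ 2 ≤ (n : ℝ) →
      marginLoss D 0 (convNet hK v) ≤ empMarginLoss S (B / a) (convNet hK v) +
        12 * √((n + Real.log (1 / (δ / m ^ 2))) / m))
    (w : Fin d → Fin k → ℝ) :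
    marginLoss D 0 (convNet hK w) ≤ empMarginLoss S γ (convNet hK w) +
      500 * √((B ^ 2 * (d : ℝ) ^ 2 * k * (ρ *
        ∑ l, (∏ i ∈ Finset.univ.erase l, (∑ c, |w i c|) ^ 2) * ∑ c, w l c ^ 2) +
          max 1 (γ ^ 2) * Real.log (m * d / δ)) / (γ ^ 2 * m)) := by
  have hm' : (1 : ℝ) ≤ m := by exact_mod_cast hm
  have hd' : (1 : ℝ) ≤ d := by exact_mod_cast hd
  set s : ℝ := ∏ l, ∑ c, |w l c| with hs
  set Φ : ℝ := ∑ l, (∏ i ∈ Finset.univ.erase l, (∑ c, |w i c|) ^ 2) * ∑ c, w l c ^ 2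
  have hΦ0 : 0 ≤ Φ := Finset.sum_nonneg fun l _ => mul_nonneg
    (Finset.prod_nonneg fun _ _ => sq_nonneg _) (Finset.sum_nonneg fun _ _ => sq_nonneg _)
  have hL0 : ∀ l, 0 ≤ ∑ c, |w l c| := fun l => Finset.sum_nonneg fun c _ => abs_nonneg _
  have hs0 : 0 ≤ s := Finset.prod_nonneg fun l _ => hL0 l
  set X : ℝ := (B ^ 2 * (d : ℝ) ^ 2 * k * (ρ * Φ) + max 1 (γ ^ 2) * Real.log (m * d / δ)) /
    (γ ^ 2 * m)
  have hL1 := marginLoss_le_one D 0 (convNet hK w)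
  rcases le_or_gt (2 * (s * B)) γ with hsmall | hbig
  · rw [empMarginLoss_eq_one hm h2K fun i j => (abs_convNet_le hK w (hS i) j).trans (by
      rw [← hs]; linarith)]
    have := Real.sqrt_nonneg X
    linarith
  have hspos : 0 < s := by
    rcases hs0.eq_or_lt with h0 | h0
    · rw [← h0] at hbig; linarith
    · exact h0
  have hLpos : ∀ l, 0 < ∑ c, |w l c| := fun l =>
    (hL0 l).lt_of_ne fun h0 => hspos.ne' (Finset.prod_eq_zero (Finset.mem_univ l) h0.symm)
  set v : Fin d → Fin k → ℝ := fun l => (∑ c, |w l c|)⁻¹ • w l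
  have hv1 : ∀ l, ∑ c, |v l c| = 1 := fun l => by
    simp only [v, Pi.smul_apply, smul_eq_mul, abs_mul, abs_inv, abs_of_pos (hLpos l)]
    rw [← Finset.mul_sum, inv_mul_cancel₀ (hLpos l).ne']
  have hwv : (fun l => (∑ c, |w l c|) • v l) = w := by
    funext l
    simp only [v, smul_smul, mul_inv_cancel₀ (hLpos l).ne', one_smul]
  have hnet : ∀ x j, convNet hK w x j = s * convNet hK v x j := fun x j => by
    conv_lhs => rw [← hwv]
    exact convNet_smul hK _ hL0 v x j
  have hnet' : ∀ x j, convNet hK v x j = s⁻¹ * convNet hK w x j := fun x j => by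
    rw [hnet, inv_mul_cancel_left₀ hspos.ne']
  have hΦv : Φ = s ^ 2 * ∑ l, ∑ c, v l c ^ 2 := by
    rw [Finset.mul_sum]
    refine Finset.sum_congr rfl fun l _ => ?_
    have e1 : ∑ c, v l c ^ 2 = ((∑ c, |w l c|) ^ 2)⁻¹ * ∑ c, w l c ^ 2 := by
      rw [Finset.mul_sum]
      exact Finset.sum_congr rfl fun c _ => by simp only [v, Pi.smul_apply, smul_eq_mul]; ring
    have e2 : s ^ 2 = (∑ c, |w l c|) ^ 2 * ∏ i ∈ Finset.univ.erase l, (∑ c, |w i c|) ^ 2 := by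
      rw [hs, ← Finset.prod_pow,
        ← Finset.mul_prod_erase Finset.univ (fun i => (∑ c, |w i c|) ^ 2) (Finset.mem_univ l)]
    rw [e1, e2]
    have := (hLpos l).ne'
    field_simp
  set Q : ℝ := ∑ l, ∑ c, v l c ^ 2
  have hkQ : (d : ℝ) ≤ k * Q := by
    have : ∑ _l : Fin d, (1 : ℝ) ≤ ∑ l, k * ∑ c, v l c ^ 2 :=
      Finset.sum_le_sum fun l _ => one_le_mul_sum_sq (hv1 l)
    rw [← Finset.mul_sum] at this
    simpa using this
  -- The least `a` for which margin `B / a` of the normalized network becomes at most `γ` after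
  -- rescaling by `s`. Since `s * B / γ > 1 / 2`, rounding up costs at most a factor `3`.
  set a : ℕ := ⌈s * B / γ⌉₊
  have hr : 1 < 2 * (s * B / γ) := by
    rw [← mul_div_assoc, one_lt_div hγ]; exact hbig
  have ha1 : 1 ≤ a := Nat.one_le_ceil_iff.2 (by linarith)
  have ha1' : (1 : ℝ) ≤ a := by exact_mod_cast ha1
  have hale : s * B / γ ≤ a := Nat.le_ceil _
  have hale3 : (a : ℝ) ≤ 3 * (s * B / γ) := by
    have := Nat.ceil_lt_add_one (show 0 ≤ s * B / γ by positivity)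
    simp only [a]
    linarith
  set κ : ℝ := 64 * d * a ^ 2 * k * Q
  -- Since `a ≤ κ`, the case `⌈κ⌉₊ ≤ m` also has `a ≤ m`, so `m²` pairs of scales suffice.
  have hκa : (a : ℝ) ≤ κ ∧ 1 ≤ κ := by
    have h1 : (1 : ℝ) ≤ k * Q := hd'.trans hkQ
    have h2 : (a : ℝ) ≤ a ^ 2 := by nlinarith
    have h3 : (a : ℝ) ^ 2 ≤ d * a ^ 2 := le_mul_of_one_le_left (by positivity) hd'
    have h4 : d * (a : ℝ) ^ 2 ≤ d * a ^ 2 * (k * Q) := le_mul_of_one_le_right (by positivity) h1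
    have h5 : κ = 64 * (d * a ^ 2 * (k * Q)) := by simp only [κ]; ring
    constructor <;> linarith
  set Z : ℝ := B ^ 2 * (d : ℝ) ^ 2 * k * (ρ * Φ) / γ ^ 2
  -- `576 = 64 * 9`, the `9` coming from rounding; the spare factor `d * ρ ≥ 1` is given away.
  have hκZ : κ ≤ 576 * Z := by
    have h1 : (a : ℝ) ^ 2 ≤ 9 * (s * B / γ) ^ 2 := by
      have := pow_le_pow_left₀ (by positivity) hale3 2
      linarith
    have hQ : 0 ≤ k * Q := by linarith
    have h2 : 576 * (d * (s * B / γ) ^ 2 * (k * Q)) ≤ 576 * Z := by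
      have e : Z = (d * ρ) * (d * (s * B / γ) ^ 2 * (k * Q)) := by
        simp only [Z]; rw [hΦv]; field_simp
      rw [e]
      have : (1 : ℝ) ≤ d * ρ := one_le_mul_of_one_le_of_one_le hd' hρ
      have h3 : 0 ≤ d * (s * B / γ) ^ 2 * (k * Q) := by positivity
      nlinarith
    have h3 : 64 * d * (k * Q) * (a : ℝ) ^ 2 ≤ 64 * d * (k * Q) * (9 * (s * B / γ) ^ 2) :=
      mul_le_mul_of_nonneg_left h1 (by positivity)
    have e : κ = 64 * d * (k * Q) * (a : ℝ) ^ 2 := by simp only [κ]; ring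
    rw [e]
    linarith
  have hlog : 0 ≤ Real.log (m * d / δ) := Real.log_nonneg (by
    rw [le_div_iff₀ hδ]; nlinarith)
  have hX : (Z + Real.log (m * d / δ)) / m ≤ X := by
    have e : X = (Z + max 1 (γ ^ 2) / γ ^ 2 * Real.log (m * d / δ)) / m := by
      simp only [X, Z]; field_simp
    rw [e]
    refine div_le_div_of_nonneg_right (add_le_add_right ?_ _) (by linarith)
    refine le_mul_of_one_le_left hlog ?_
    rw [one_le_div (by positivity)]
    exact le_max_right _ _
  have hemp0 := empMarginLoss_nonneg S γ (convNet hK w)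
  -- If the complexity exceeds `m`, then `√X ≥ 1 / 24` and the right side exceeds `1`.
  rcases lt_or_ge m ⌈κ⌉₊ with hmn | hmn
  · have h1 : (m : ℝ) < κ := Nat.lt_ceil.1 hmn
    have h2 : 1 / 576 ≤ X := by
      refine le_trans ?_ hX
      rw [div_le_div_iff₀ (by norm_num) (by linarith)]
      linarith
    have h3 : 1 / 24 ≤ √X := Real.le_sqrt_of_sq_le (by norm_num; linarith)
    linarith
  · have hn1 : 1 ≤ ⌈κ⌉₊ := Nat.one_le_ceil_iff.2 (by linarith [hκa.2])
    have ham : a ≤ m := by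
      refine le_trans ?_ hmn
      exact_mod_cast hκa.1.trans (Nat.le_ceil κ)
    have main := good a (Finset.mem_Icc.2 ⟨ha1, ham⟩) _ (Finset.mem_Icc.2 ⟨hn1, hmn⟩) v hv1
      (Nat.le_ceil κ)
    have e1 : marginError 0 (convNet hK w) = marginError 0 (convNet hK v) :=
      (marginError_subset (inv_pos.2 hspos).le hnet' (by simp)).antisymm
        (marginError_subset hs0 hnet (by simp))
    have e2 : marginLoss D 0 (convNet hK w) = marginLoss D 0 (convNet hK v) := by
      simp only [marginLoss, e1]
    have e3 : empMarginLoss S (B / a) (convNet hK v) ≤ empMarginLoss S γ (convNet hK w) := by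
      refine div_le_div_of_nonneg_right (Finset.sum_le_sum fun i _ => ?_) (Nat.cast_nonneg _)
      refine Set.indicator_le_indicator_of_subset (marginError_subset hs0 hnet ?_)
        (fun _ => zero_le_one) _
      rw [← mul_div_assoc, div_le_iff₀ (by linarith)]
      rw [div_le_iff₀ hγ] at hale
      linarith
    -- `⌈κ⌉₊ ≤ 2 * κ ≤ 1152 * Z`, `1152 ≤ 40²`, and `12 * 40 ≤ 500`.
    have e4 : 12 * √((⌈κ⌉₊ + Real.log (1 / (δ / m ^ 2))) / m) ≤ 500 * √X := by
      have hn : (⌈κ⌉₊ : ℝ) ≤ 2 * κ := by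
        have := Nat.ceil_lt_add_one (show 0 ≤ κ by linarith [hκa.2])
        linarith [hκa.2]
      have hl := log_one_div_div_sq_le hm' hd' hδ hδ1.le
      have hle : (⌈κ⌉₊ + Real.log (1 / (δ / m ^ 2))) / m ≤ 40 ^ 2 * X := by
        have h1 : (⌈κ⌉₊ + Real.log (1 / (δ / m ^ 2))) / m ≤
            1152 * ((Z + Real.log (m * d / δ)) / m) := by
          rw [← mul_div_assoc]
          exact div_le_div_of_nonneg_right (by linarith) (by linarith)
        have h2 : 0 ≤ (Z + Real.log (m * d / δ)) / m :=
          div_nonneg (by linarith [hκa.2]) (by linarith)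
        linarith
      have := Real.sqrt_le_sqrt hle
      rw [Real.sqrt_mul (by norm_num), Real.sqrt_sq (by norm_num)] at this
      have := Real.sqrt_nonneg X
      linarith
    rw [e2]
    linarith

/-- The exceptional set lies in the null event of an input beyond norm `B` together with `m²` bad
events of probability at most `δ / m²`. -/
theorem pi_generalization (hK : K ≤ h) (hd : 1 ≤ d) (h2K : 2 ≤ K) (hm : 1 ≤ m)
    {B ψmin ψmax : ℝ} (hB : 0 < B) (hψ : 0 < ψmin) (hψ' : ψmin ≤ ψmax)
    (D : Measure (EuclideanSpace ℝ (Fin h) × Fin K)) [IsProbabilityMeasure D]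
    (hD : ∀ᵐ z ∂D, ‖z.1‖ ≤ B) {γ δ : ℝ} (hγ : 0 < γ) (hδ : 0 < δ) :
    Measure.pi (fun _ : Fin m => D) {S | ¬ ∀ w : Fin d → Fin k → ℝ,
      marginLoss D 0 (convNet hK w) ≤ empMarginLoss S γ (convNet hK w) +
        500 * √((B ^ 2 * (d : ℝ) ^ 2 * k * kernelComplexity ψmin ψmax w +
          max 1 (γ ^ 2) * Real.log (m * d / δ)) / (γ ^ 2 * m))} ≤ ENNReal.ofReal δ := by
  rcases le_or_gt 1 δ with h1 | hδ1
  · exact prob_le_one.trans (by simpa using ENNReal.ofReal_le_ofReal h1)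
  have hm' : (1 : ℝ) ≤ m := by exact_mod_cast hm
  set P := Measure.pi fun _ : Fin m => D
  have hnull : P {S | ¬ ∀ i, ‖(S i).1‖ ≤ B} = 0 := by
    have : ∀ᵐ S ∂P, ∀ i, ‖(S i).1‖ ≤ B := ae_all_iff.2 fun i =>
      (Measure.quasiMeasurePreserving_eval (fun _ : Fin m => D) i).ae hD
    exact this
  have hρ : 1 ≤ ψmax ^ 2 / ψmin ^ 2 := by
    rw [one_le_div (by positivity)]
    exact pow_le_pow_left₀ hψ.le hψ' 2
  let Bad : ℕ → ℕ → Set (Fin m → EuclideanSpace ℝ (Fin h) × Fin K) := fun a n =>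
    {S | (∀ i, ‖(S i).1‖ ≤ B) ∧ ∃ v : Fin d → Fin k → ℝ,
      (∀ l, ∑ c, |v l c| = 1) ∧ 64 * d * a ^ 2 * k * ∑ l, ∑ c, v l c ^ 2 ≤ (n : ℝ) ∧
      empMarginLoss S (B / a) (convNet hK v) + 12 * √((n + Real.log (1 / (δ / m ^ 2))) / m) <
        marginLoss D 0 (convNet hK v)}
  have hBad : ∀ a ∈ Finset.Icc 1 m, ∀ n ∈ Finset.Icc 1 m,
      P (Bad a n) ≤ ENNReal.ofReal (δ / m ^ 2) := fun a ha n _ =>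
    pi_deviation_le hK hd hm hB D hD (Finset.mem_Icc.1 ha).1 (by positivity) (by
      rw [div_le_one (by positivity)]
      exact hδ1.le.trans (one_le_pow₀ hm'))
  refine (measure_mono (t := {S | ¬ ∀ i, ‖(S i).1‖ ≤ B} ∪
    ⋃ a ∈ Finset.Icc 1 m, ⋃ n ∈ Finset.Icc 1 m, Bad a n) ?_).trans ?_
  · intro S hS
    by_contra hcon
    simp only [Set.mem_union, Set.mem_ofPred_eq, Set.mem_iUnion, not_or, not_not, not_exists]
      at hcon
    refine hS fun w => marginLoss_le_of_normalized hK hd h2K hm hB hρ D hγ hδ hδ1 hcon.1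
      (fun a ha n hn v hv1 hv2 => ?_) w
    by_contra hlt
    exact hcon.2 a ha n hn ⟨hcon.1, v, hv1, hv2, not_le.1 hlt⟩
  · refine (measure_union_le _ _).trans ?_
    rw [hnull, zero_add]
    refine (measure_biUnion_finset_le _ _).trans ((Finset.sum_le_sum fun a ha =>
      (measure_biUnion_finset_le _ _).trans (Finset.sum_le_sum fun n hn =>
        hBad a ha n hn)).trans ?_)
    simp only [Finset.sum_const, Nat.card_Icc, add_tsub_cancel_right, nsmul_eq_mul]
    rw [← ENNReal.ofReal_natCast, ← ENNReal.ofReal_mul (by positivity),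
      ← ENNReal.ofReal_mul (by positivity)]
    refine ENNReal.ofReal_le_ofReal (le_of_eq ?_)
    field_simp

end Generalization

/-! ### Lower bound for Toeplitz sections through the symbol. -/

section Toeplitz

theorem integral_cos_int (n : ℤ) :
    ∫ ω in (0 : ℝ)..2 * Real.pi, Real.cos (n * ω) = if n = 0 then 2 * Real.pi else 0 := by
  split_ifs with hn
  · simp [hn]
  · have hn' : (n : ℝ) ≠ 0 := by exact_mod_cast hn
    rw [intervalIntegral.integral_comp_mul_left (fun x => Real.cos x) hn']
    simp [integral_cos, ← mul_assoc]
    have := Real.sin_int_mul_pi (n * 2)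
    push_cast at this
    right
    exact this

theorem integral_cos_mul_cos (n j : ℤ) :
    ∫ ω in (0 : ℝ)..2 * Real.pi, Real.cos (n * ω) * Real.cos (j * ω) =
      Real.pi * ((if n = j then 1 else 0) + if n = -j then 1 else 0) := by
  have e : ∀ ω : ℝ, Real.cos (n * ω) * Real.cos (j * ω) =
      (Real.cos ((n - j : ℤ) * ω) + Real.cos ((n + j : ℤ) * ω)) / 2 := fun ω => by
    push_cast
    rw [sub_mul, add_mul, Real.cos_add, Real.cos_sub]
    ring
  simp_rw [e]
  rw [intervalIntegral.integral_div, intervalIntegral.integral_add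
    (Continuous.intervalIntegrable (by fun_prop) _ _)
    (Continuous.intervalIntegrable (by fun_prop) _ _), integral_cos_int, integral_cos_int]
  simp only [sub_eq_zero, add_eq_zero_iff_eq_neg]
  split_ifs <;> ring

variable {t : ℤ → ℝ}

theorem summable_symbol (ht : Summable t) (ω : ℝ) :
    Summable fun i : ℤ => (t i : ℂ) * Complex.exp (-(i : ℂ) * (ω : ℂ) * Complex.I) := by
  refine Summable.of_norm_bounded ht.abs fun i => le_of_eq ?_
  have : -(i : ℂ) * (ω : ℂ) * Complex.I = ((-i * ω : ℝ) : ℂ) * Complex.I := by push_cast; ring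
  rw [this, norm_mul, Complex.norm_exp_ofReal_mul_I, mul_one, Complex.norm_real, Real.norm_eq_abs]

theorem symbol_re (ht : Summable t) (ω : ℝ) :
    (symbol t ω).re = ∑' i : ℤ, t i * Real.cos (i * ω) := by
  rw [symbol, Complex.re_tsum (summable_symbol ht ω)]
  refine tsum_congr fun i => ?_
  have : -(i : ℂ) * (ω : ℂ) * Complex.I = ((-(i * ω) : ℝ) : ℂ) * Complex.I := by push_cast; ring
  rw [this, Complex.re_ofReal_mul, Complex.exp_ofReal_mul_I_re, Real.cos_neg]

theorem continuous_symbol_re (ht : Summable t) : Continuous fun ω => (symbol t ω).re := by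
  simp_rw [symbol_re ht]
  refine continuous_tsum (fun i => by fun_prop) ht.abs fun i ω => ?_
  rw [norm_mul, Real.norm_eq_abs]
  exact mul_le_of_le_one_right (abs_nonneg _) (Real.abs_cos_le_one _)

/-- Cosines see only the symmetric part of `t`, which is all that a quadratic form sees. -/
theorem integral_symbol_re_mul_cos (ht : Summable t) (j : ℤ) :
    ∫ ω in (0 : ℝ)..2 * Real.pi, (symbol t ω).re * Real.cos (j * ω) =
      Real.pi * (t j + t (-j)) := by
  have hsum := intervalIntegral.hasSum_intervalIntegral_of_summable_norm (a := 0) (b := 2 * Real.pi)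
    (f := fun i : ℤ => (⟨fun ω => t i * Real.cos (i * ω) * Real.cos (j * ω), by fun_prop⟩ :
      C(ℝ, ℝ))) (by
    refine Summable.of_nonneg_of_le (fun _ => norm_nonneg _) (fun i => ?_) ht.abs
    refine (ContinuousMap.norm_le _ (abs_nonneg _)).2 fun ω => ?_
    simp only [ContinuousMap.restrict_apply, ContinuousMap.coe_mk, norm_mul, Real.norm_eq_abs]
    exact mul_le_of_le_one_right (by positivity) (Real.abs_cos_le_one _) |>.trans
      (mul_le_of_le_one_right (abs_nonneg _) (Real.abs_cos_le_one _)))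
  simp only [ContinuousMap.coe_mk] at hsum
  have e : ∀ ω : ℝ, (symbol t ω).re * Real.cos (j * ω) =
      ∑' i : ℤ, t i * Real.cos (i * ω) * Real.cos (j * ω) := fun ω => by
    rw [symbol_re ht, tsum_mul_right]
  simp_rw [e]
  rw [← hsum.tsum_eq]
  have e2 : ∀ i : ℤ, ∫ ω in (0 : ℝ)..2 * Real.pi, t i * Real.cos (i * ω) * Real.cos (j * ω) =
      (if i = j then Real.pi * t j else 0) + if i = -j then Real.pi * t (-j) else 0 := fun i => by
    simp_rw [mul_assoc]
    rw [intervalIntegral.integral_const_mul, integral_cos_mul_cos]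
    simp only [mul_add, mul_ite, mul_one, mul_zero]
    congr 1 <;> split_ifs with h
    · rw [h, mul_comm]
    · rfl
    · rw [h, mul_comm]
    · rfl
  simp_rw [e2]
  rw [Summable.tsum_add, tsum_ite_eq, tsum_ite_eq]
  · ring
  · exact (hasSum_ite_eq j _).summable
  · exact (hasSum_ite_eq (-j) _).summable

theorem sum_sum_mul_cos {n : ℕ} (v : Fin n → ℝ) (ω : ℝ) :
    ∑ p, ∑ q, v p * v q * Real.cos (((p : ℤ) - (q : ℤ) : ℤ) * ω) =
      (∑ p, v p * Real.cos (p * ω)) ^ 2 + (∑ p, v p * Real.sin (p * ω)) ^ 2 := by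
  rw [sq, sq, Finset.sum_mul_sum, Finset.sum_mul_sum, ← Finset.sum_add_distrib]
  refine Finset.sum_congr rfl fun p _ => ?_
  rw [← Finset.sum_add_distrib]
  refine Finset.sum_congr rfl fun q _ => ?_
  push_cast
  rw [sub_mul, Real.cos_sub]
  ring

/-- The quadratic form of a Toeplitz section in terms of the symbol. -/
theorem integral_symbol_re_mul_sq (ht : Summable t) {n : ℕ} (v : Fin n → ℝ) :
    ∫ ω in (0 : ℝ)..2 * Real.pi, (symbol t ω).re *
      ((∑ p, v p * Real.cos (p * ω)) ^ 2 + (∑ p, v p * Real.sin (p * ω)) ^ 2) =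
      2 * Real.pi * ∑ p, v p * (toeplitzSection n t).mulVec v p := by
  have hc := continuous_symbol_re ht
  simp_rw [← sum_sum_mul_cos, Finset.mul_sum]
  rw [intervalIntegral.integral_finsetSum
    fun p _ => Continuous.intervalIntegrable (by fun_prop) _ _]
  have e : ∀ p q : Fin n, ∫ ω in (0 : ℝ)..2 * Real.pi, (symbol t ω).re *
      (v p * v q * Real.cos (((p : ℤ) - (q : ℤ) : ℤ) * ω)) =
      Real.pi * (v p * v q * t (p - q)) + Real.pi * (v q * v p * t (q - p)) := fun p q => by
    simp_rw [mul_left_comm _ (v p * v q)]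
    rw [intervalIntegral.integral_const_mul, integral_symbol_re_mul_cos ht, neg_sub]
    ring
  have e2 : ∀ p : Fin n, ∫ ω in (0 : ℝ)..2 * Real.pi, ∑ q, (symbol t ω).re *
      (v p * v q * Real.cos (((p : ℤ) - (q : ℤ) : ℤ) * ω)) =
      ∑ q : Fin n, (Real.pi * (v p * v q * t (p - q)) + Real.pi * (v q * v p * t (q - p))) :=
    fun p => by
      rw [intervalIntegral.integral_finsetSum
        fun q _ => Continuous.intervalIntegrable (by fun_prop) _ _]
      exact Finset.sum_congr rfl fun q _ => e p q
  simp_rw [e2, Finset.sum_add_distrib]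
  rw [Finset.sum_comm (f := fun p q : Fin n => Real.pi * (v q * v p * t (q - p)))]
  simp only [← Finset.mul_sum, toeplitzSection, Matrix.mulVec, dotProduct, Matrix.of_apply]
  rw [← two_mul, ← mul_assoc]
  congr 1
  refine Finset.sum_congr rfl fun p _ => ?_
  rw [Finset.mul_sum]
  exact Finset.sum_congr rfl fun q _ => by ring

theorem integral_sq {n : ℕ} (v : Fin n → ℝ) :
    ∫ ω in (0 : ℝ)..2 * Real.pi,
      ((∑ p, v p * Real.cos (p * ω)) ^ 2 + (∑ p, v p * Real.sin (p * ω)) ^ 2) =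
      2 * Real.pi * ∑ p, v p ^ 2 := by
  simp_rw [← sum_sum_mul_cos]
  rw [intervalIntegral.integral_finsetSum
    fun p _ => Continuous.intervalIntegrable (by fun_prop) _ _, Finset.mul_sum]
  refine Finset.sum_congr rfl fun p _ => ?_
  rw [intervalIntegral.integral_finsetSum
    fun p _ => Continuous.intervalIntegrable (by fun_prop) _ _]
  simp_rw [intervalIntegral.integral_const_mul, integral_cos_int, sub_eq_zero]
  rw [Finset.sum_eq_single p]
  · simp; ring
  · intro q _ hq
    rw [if_neg, mul_zero]
    intro h
    exact hq (Fin.ext (by exact_mod_cast h.symm))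
  · simp

theorem le_quadratic_form (ht : Summable t) {c : ℝ}
    (hc : ∀ ω ∈ Set.Icc (0 : ℝ) (2 * Real.pi), c ≤ (symbol t ω).re) {n : ℕ} (v : Fin n → ℝ) :
    c * ∑ p, v p ^ 2 ≤ ∑ p, v p * (toeplitzSection n t).mulVec v p := by
  have hcont := continuous_symbol_re ht
  have h1 : ∫ ω in (0 : ℝ)..2 * Real.pi, c *
      ((∑ p, v p * Real.cos (p * ω)) ^ 2 + (∑ p, v p * Real.sin (p * ω)) ^ 2) ≤
      ∫ ω in (0 : ℝ)..2 * Real.pi, (symbol t ω).re *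
      ((∑ p, v p * Real.cos (p * ω)) ^ 2 + (∑ p, v p * Real.sin (p * ω)) ^ 2) := by
    refine intervalIntegral.integral_mono_on (by positivity)
      (Continuous.intervalIntegrable (by fun_prop) _ _)
      (Continuous.intervalIntegrable (by fun_prop) _ _) fun ω hω => ?_
    exact mul_le_mul_of_nonneg_right (hc ω hω) (by positivity)
  rw [intervalIntegral.integral_const_mul, integral_sq, integral_symbol_re_mul_sq ht] at h1
  have := Real.pi_pos
  nlinarith

theorem symbol_neg (t : ℤ → ℝ) (ω : ℝ) : symbol (-t) ω = -symbol t ω := by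
  simp [symbol, tsum_neg]

/-- Expand `0 ≤ ‖M v - c v‖²`. -/
theorem mul_sum_sq_le_of_quadratic_form {n : ℕ} {M : Matrix (Fin n) (Fin n) ℝ} {c : ℝ}
    (hc : 0 ≤ c) {v : Fin n → ℝ} (h : c * ∑ p, v p ^ 2 ≤ ∑ p, v p * M.mulVec v p) :
    c ^ 2 * ∑ p, v p ^ 2 ≤ ∑ p, M.mulVec v p ^ 2 := by
  have h1 : 0 ≤ ∑ p, (M.mulVec v p - c * v p) ^ 2 := Finset.sum_nonneg fun p _ => sq_nonneg _
  have e : ∀ p, (M.mulVec v p - c * v p) ^ 2 =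
      M.mulVec v p ^ 2 - 2 * c * (v p * M.mulVec v p) + c ^ 2 * v p ^ 2 := fun p => by ring
  simp_rw [e, Finset.sum_add_distrib, Finset.sum_sub_distrib, ← Finset.mul_sum] at h1
  nlinarith [mul_le_mul_of_nonneg_left h hc]

/-- A Toeplitz section with real-valued symbol bounded away from `0` is bounded below. -/
theorem mul_sum_sq_le_toeplitz (ht : Summable t) {c : ℝ} (hc : 0 < c)
    (hψ : ∀ ω ∈ Set.Icc (0 : ℝ) (2 * Real.pi), c ≤ ‖symbol t ω‖)
    (him : ∀ ω ∈ Set.Icc (0 : ℝ) (2 * Real.pi), (symbol t ω).im = 0) {n : ℕ} (v : Fin n → ℝ) :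
    c ^ 2 * ∑ p, v p ^ 2 ≤ ∑ p, (toeplitzSection n t).mulVec v p ^ 2 := by
  have habs : ∀ ω ∈ Set.Icc (0 : ℝ) (2 * Real.pi), c ≤ |(symbol t ω).re| := fun ω hω => by
    have : symbol t ω = ((symbol t ω).re : ℂ) := Complex.ext (by simp) (by simp [him ω hω])
    have h2 := hψ ω hω
    rw [this, Complex.norm_real, Real.norm_eq_abs] at h2
    exact h2
  -- A continuous real function avoiding `(-c, c)` keeps its sign; the negative case is reduced to
  -- `-t`.
  have hsign : (∀ ω ∈ Set.Icc (0 : ℝ) (2 * Real.pi), c ≤ (symbol t ω).re) ∨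
      ∀ ω ∈ Set.Icc (0 : ℝ) (2 * Real.pi), c ≤ -(symbol t ω).re := by
    by_contra hcon
    push Not at hcon
    obtain ⟨⟨ω₁, h1, l1⟩, ω₂, h2, l2⟩ := hcon
    have n1 : (symbol t ω₁).re ≤ 0 := by
      rcases le_abs.1 (habs _ h1) with h | h <;> linarith
    have n2 : 0 ≤ (symbol t ω₂).re := by
      rcases le_abs.1 (habs _ h2) with h | h <;> linarith
    obtain ⟨ω, hω, h0⟩ := (convex_Icc (0 : ℝ) (2 * Real.pi)).isPreconnected.intermediate_value
      h1 h2 (continuous_symbol_re ht).continuousOn ⟨n1, n2⟩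
    have := habs ω hω
    simp only at h0
    rw [h0, abs_zero] at this
    linarith
  rcases hsign with h | h
  · exact mul_sum_sq_le_of_quadratic_form hc.le (le_quadratic_form ht h v)
  · have e : toeplitzSection n (-t) = -toeplitzSection n t := by
      ext p q; simp [toeplitzSection]
    have := mul_sum_sq_le_of_quadratic_form hc.le (le_quadratic_form (c := c) ht.neg
      (fun ω hω => by
        have e2 : symbol (fun i => -t i) ω = -symbol t ω := symbol_neg t ω
        rw [e2]; simpa using h ω hω) v)
    have e3 : toeplitzSection n (fun i => -t i) = -toeplitzSection n t := e
    rw [e3] at this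
    simpa [Matrix.neg_mulVec] using this

end Toeplitz

/-! ### Layerwise perturbation in spectral norm. -/

section Perturbation

variable {h : ℕ}

theorem specNorm_nonneg (M : Matrix (Fin h) (Fin h) ℝ) : 0 ≤ specNorm M := norm_nonneg _

theorem norm_mulVec_le (M : Matrix (Fin h) (Fin h) ℝ) (x : Fin h → ℝ) :
    ‖WithLp.toLp 2 (M.mulVec x)‖ ≤ specNorm M * ‖WithLp.toLp 2 x‖ := by
  have := (Matrix.toEuclideanCLM (n := Fin h) (𝕜 := ℝ) M).le_opNorm (WithLp.toLp 2 x)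
  rwa [Matrix.toEuclideanCLM_toLp] at this

theorem specNorm_sq_le (M : Matrix (Fin h) (Fin h) ℝ) :
    specNorm M ^ 2 ≤ ∑ i, ∑ j, M i j ^ 2 := by
  have h0 : 0 ≤ ∑ i, ∑ j, M i j ^ 2 :=
    Finset.sum_nonneg fun _ _ => Finset.sum_nonneg fun _ _ => sq_nonneg _
  have : specNorm M ≤ √(∑ i, ∑ j, M i j ^ 2) := by
    refine ContinuousLinearMap.opNorm_le_bound _ (Real.sqrt_nonneg _) fun x => ?_
    refine le_of_sq_le_sq ?_ (by positivity)
    rw [mul_pow, Real.sq_sqrt h0, EuclideanSpace.real_norm_sq_eq, EuclideanSpace.real_norm_sq_eq,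
      Finset.sum_mul]
    refine Finset.sum_le_sum fun i _ => ?_
    have := Finset.sum_mul_sq_le_sq_mul_sq Finset.univ (fun j => M i j) fun j => x j
    simpa [Matrix.ofLp_toEuclideanCLM, Matrix.mulVec, dotProduct] using this
  calc specNorm M ^ 2 ≤ √(∑ i, ∑ j, M i j ^ 2) ^ 2 :=
        pow_le_pow_left₀ (specNorm_nonneg M) this 2
    _ = _ := Real.sq_sqrt h0

theorem norm_relu_le (z : Fin h → ℝ) :
    ‖WithLp.toLp 2 fun i => max 0 (z i)‖ ≤ ‖WithLp.toLp 2 z‖ := by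
  refine le_of_sq_le_sq ?_ (norm_nonneg _)
  rw [EuclideanSpace.real_norm_sq_eq, EuclideanSpace.real_norm_sq_eq]
  exact Finset.sum_le_sum fun i _ => relu_sq_le _

theorem norm_relu_sub_le (z z' : Fin h → ℝ) :
    ‖WithLp.toLp 2 ((fun i => max 0 (z i)) - fun i => max 0 (z' i))‖ ≤
      ‖WithLp.toLp 2 (z - z')‖ := by
  refine le_of_sq_le_sq ?_ (norm_nonneg _)
  rw [EuclideanSpace.real_norm_sq_eq, EuclideanSpace.real_norm_sq_eq]
  exact Finset.sum_le_sum fun i _ => relu_sub_sq_le _ _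

theorem norm_network_le (d : ℕ) (W : Fin d → Matrix (Fin h) (Fin h) ℝ) (x : Fin h → ℝ) :
    ‖WithLp.toLp 2 (network d W x)‖ ≤ (∏ l, specNorm (W l)) * ‖WithLp.toLp 2 x‖ := by
  match d with
  | 0 => simp [network]
  | 1 => simpa [network] using norm_mulVec_le (W 0) x
  | d + 2 =>
    have ih := norm_network_le (d + 1) (fun l => W l.castSucc) x
    rw [network, Fin.prod_univ_castSucc, mul_comm (∏ i : Fin (d + 1), _), mul_assoc]
    exact (norm_mulVec_le _ _).trans
      (mul_le_mul_of_nonneg_left ((norm_relu_le _).trans ih) (specNorm_nonneg _))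

/-- The fresh perturbation `U` acts on the unperturbed activation `z'`, so perturbed activations
need no bound of their own. -/
theorem norm_mulVec_add_sub_le (W U : Matrix (Fin h) (Fin h) ℝ) (z z' : Fin h → ℝ) :
    ‖WithLp.toLp 2 ((W + U).mulVec z - W.mulVec z')‖ ≤
      (specNorm W + specNorm U) * ‖WithLp.toLp 2 (z - z')‖ +
        specNorm U * ‖WithLp.toLp 2 z'‖ := by
  have e : (W + U).mulVec z - W.mulVec z' =
      W.mulVec (z - z') + U.mulVec (z - z') + U.mulVec z' := by
    rw [Matrix.add_mulVec, Matrix.mulVec_sub, Matrix.mulVec_sub]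
    abel
  rw [e, WithLp.toLp_add, WithLp.toLp_add]
  refine (norm_add₃_le).trans ?_
  have h1 := norm_mulVec_le W (z - z')
  have h2 := norm_mulVec_le U (z - z')
  have h3 := norm_mulVec_le U z'
  linarith

theorem prod_erase_castSucc {d : ℕ} (s : Fin (d + 1) → ℝ) (l : Fin d) :
    ∏ i ∈ Finset.univ.erase l.castSucc, s i =
      (∏ i ∈ Finset.univ.erase l, s i.castSucc) * s (Fin.last d) := by
  rw [Fin.univ_castSuccEmb, Finset.cons_eq_insert, Finset.erase_insert_of_ne
    (Fin.castSucc_lt_last l).ne', Finset.prod_insert, mul_comm]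
  · congr 1
    have : (Finset.univ.map Fin.castSuccEmb).erase l.castSucc =
        (Finset.univ.erase l).map Fin.castSuccEmb := by
      rw [Finset.map_erase]; rfl
    rw [this, Finset.prod_map]
    rfl
  · simp [(Fin.castSucc_lt_last _).ne]

theorem prod_erase_last {d : ℕ} (s : Fin (d + 1) → ℝ) :
    ∏ i ∈ Finset.univ.erase (Fin.last d), s i = ∏ i : Fin d, s i.castSucc := by
  rw [Fin.univ_castSuccEmb, Finset.cons_eq_insert, Finset.erase_insert, Finset.prod_map]
  · rfl
  · simp [(Fin.castSucc_lt_last _).ne]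

/-- Layerwise perturbation bound. -/
theorem norm_network_add_sub_le {r : ℝ} (hr : 0 ≤ r) (d : ℕ)
    (W U : Fin d → Matrix (Fin h) (Fin h) ℝ)
    (hU : ∀ l, specNorm (U l) ≤ r * specNorm (W l)) (x : Fin h → ℝ) :
    ‖WithLp.toLp 2 (network d (W + U) x - network d W x)‖ ≤
      (1 + r) ^ d * ‖WithLp.toLp 2 x‖ *
        ∑ l, (∏ i ∈ Finset.univ.erase l, specNorm (W i)) * specNorm (U l) := by
  match d with
  | 0 => simp [network]
  | 1 =>
    have h1 := norm_mulVec_add_sub_le (W 0) (U 0) x x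
    simp only [sub_self, WithLp.toLp_zero, norm_zero, mul_zero, zero_add] at h1
    simp only [network, Pi.add_apply, Finset.univ_unique, Fin.default_eq_zero,
      Finset.sum_singleton, pow_one]
    have e : ∏ i ∈ ({0} : Finset (Fin 1)).erase 0, specNorm (W i) = 1 := by simp
    rw [e, one_mul]
    refine h1.trans ?_
    have : 0 ≤ r * (‖WithLp.toLp 2 x‖ * specNorm (U 0)) :=
      mul_nonneg hr (mul_nonneg (norm_nonneg _) (specNorm_nonneg _))
    linarith
  | d + 2 =>
    have ih := norm_network_add_sub_le hr (d + 1) (fun l => W l.castSucc) (fun l => U l.castSucc)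
      (fun l => hU l.castSucc) x
    have hz := norm_network_le (d + 1) (fun l => W l.castSucc) x
    simp only [network]
    have hsplit : (fun l : Fin (d + 1) => (W + U) l.castSucc) =
        (fun l => W l.castSucc) + fun l => U l.castSucc := rfl
    rw [hsplit, Pi.add_apply]
    refine (norm_mulVec_add_sub_le _ _ _ _).trans ?_
    set a := specNorm (W (Fin.last (d + 1)))
    set b := specNorm (U (Fin.last (d + 1)))
    have ha : 0 ≤ a := specNorm_nonneg _
    have hb : 0 ≤ b := specNorm_nonneg _
    have hab : b ≤ r * a := hU _
    set X := ‖WithLp.toLp 2 x‖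
    have hX : 0 ≤ X := norm_nonneg _
    rw [Fin.sum_univ_castSucc, prod_erase_last]
    simp_rw [prod_erase_castSucc (fun i => specNorm (W i))]
    set T := ∑ l : Fin (d + 1), (∏ i ∈ Finset.univ.erase l, specNorm (W i.castSucc)) *
      specNorm (U l.castSucc)
    have e1 : ∑ l : Fin (d + 1), (∏ i ∈ Finset.univ.erase l, specNorm (W i.castSucc)) * a *
        specNorm (U l.castSucc) = a * T := by
      simp only [T, Finset.mul_sum]
      exact Finset.sum_congr rfl fun l _ => by ring
    have hT : 0 ≤ T := Finset.sum_nonneg fun l _ => mul_nonneg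
      (Finset.prod_nonneg fun _ _ => specNorm_nonneg _) (specNorm_nonneg _)
    set Wp := ∏ i : Fin (d + 1), specNorm (W i.castSucc)
    have hWp : 0 ≤ Wp := Finset.prod_nonneg fun _ _ => specNorm_nonneg _
    rw [e1]
    have s1 : (a + b) * ‖WithLp.toLp 2 ((fun i => max 0 (network (d + 1)
          ((fun l => W l.castSucc) + fun l => U l.castSucc) x i)) -
          fun i => max 0 (network (d + 1) (fun l => W l.castSucc) x i))‖ ≤
        ((1 + r) * a) * ((1 + r) ^ (d + 1) * X * T) :=
      mul_le_mul (by linarith) ((norm_relu_sub_le _ _).trans ih) (norm_nonneg _) (by positivity)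
    have s2 : b * ‖WithLp.toLp 2 fun i =>
        max 0 (network (d + 1) (fun l => W l.castSucc) x i)‖ ≤ b * (Wp * X) :=
      mul_le_mul_of_nonneg_left ((norm_relu_le _).trans hz) hb
    have s3 : b * (Wp * X) ≤ (1 + r) ^ (d + 2) * (b * (Wp * X)) :=
      le_mul_of_one_le_left (mul_nonneg hb (mul_nonneg hWp hX))
        (one_le_pow₀ (le_add_of_nonneg_right hr))
    have e2 : (1 + r) ^ (d + 2) * X * (a * T + Wp * b) =
        ((1 + r) * a) * ((1 + r) ^ (d + 1) * X * T) + (1 + r) ^ (d + 2) * (b * (Wp * X)) := by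
      ring
    rw [e2]
    linarith

end Perturbation

/-! ### The sensitivity matrices dominate. -/

section Dominance

variable {d h k K : ℕ}

theorem sum_toep_sq (v : Fin k → ℝ) :
    ∑ i, ∑ j, toep h v i j ^ 2 = ∑ p, (kernelMap h k).mulVec v p ^ 2 := by
  rw [← vec_toep, ← finProdFinEquiv.sum_comp, Fintype.sum_prod_type]
  simp [vec]

theorem toep_add (v u : Fin k → ℝ) : toep h (v + u) = toep h v + toep h u := by
  ext i j
  simp only [toep, Matrix.of_apply, Matrix.add_apply, Pi.add_apply]
  split_ifs <;> simp

theorem sensitivity_dominates (hK : K ≤ h) (hd : 1 ≤ d) {B ψmin : ℝ} (hψ : 0 < ψmin)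
    {t : ℤ → ℝ} (ht : Summable t)
    (hle : ∀ ω ∈ Set.Icc (0 : ℝ) (2 * Real.pi), ψmin ≤ ‖symbol t ω‖)
    (him : ∀ ω ∈ Set.Icc (0 : ℝ) (2 * Real.pi), (symbol t ω).im = 0) (w u : Fin d → Fin k → ℝ)
    (hu : ∀ l, specNorm (toep h (u l)) ≤ 1 / (d : ℝ) * specNorm (toep h (w l)))
    {x : EuclideanSpace ℝ (Fin h)} (hx : ‖x‖ ≤ B) (j : Fin K) :
    |convNet hK (w + u) x j - convNet hK w x j| ^ 2 ≤
      ∑ l, ∑ p, ((sensitivity (h := h) B ψmin t w l).mulVec (u l) p) ^ 2 := by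
  have hB : 0 ≤ B := (norm_nonneg x).trans hx
  have hd' : (0 : ℝ) < d := by exact_mod_cast hd
  set W : Fin d → Matrix (Fin h) (Fin h) ℝ := fun l => toep h (w l)
  set U : Fin d → Matrix (Fin h) (Fin h) ℝ := fun l => toep h (u l)
  set c : Fin d → ℝ := fun l => ∏ i ∈ Finset.univ.erase l, specNorm (W i)
  have hc : ∀ l, 0 ≤ c l := fun l => Finset.prod_nonneg fun _ _ => specNorm_nonneg _
  have hWU : (fun l => toep h ((w + u) l)) = W + U := by
    funext l; simp only [W, U, Pi.add_apply, toep_add]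
  have hexp : (1 + 1 / (d : ℝ)) ^ d ≤ Real.exp 1 := by
    have h1 : 1 + 1 / (d : ℝ) ≤ Real.exp (1 / d) := by
      rw [add_comm]; exact Real.add_one_le_exp _
    refine (pow_le_pow_left₀ (by positivity) h1 d).trans (le_of_eq ?_)
    rw [← Real.exp_nat_mul, mul_one_div_cancel hd'.ne']
  have hnet := norm_network_add_sub_le (r := 1 / (d : ℝ)) (by positivity) d W U hu fun i => x i
  have hS0 : 0 ≤ ∑ l, c l * specNorm (U l) :=
    Finset.sum_nonneg fun l _ => mul_nonneg (hc l) (specNorm_nonneg _)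
  have hnet2 : ‖WithLp.toLp 2 (network d (W + U) (fun i => x i) - network d W fun i => x i)‖ ≤
      Real.exp 1 * B * ∑ l, c l * specNorm (U l) := by
    refine hnet.trans (mul_le_mul_of_nonneg_right ?_ hS0)
    exact mul_le_mul hexp hx (norm_nonneg _) (Real.exp_pos _).le
  have hcoord : |convNet hK (w + u) x j - convNet hK w x j| ^ 2 ≤
      ‖WithLp.toLp 2 (network d (W + U) (fun i => x i) - network d W fun i => x i)‖ ^ 2 := by
    rw [EuclideanSpace.real_norm_sq_eq, sq_abs]
    simp only [convNet, hWU]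
    exact Finset.single_le_sum (f := fun i =>
      (network d (W + U) (fun i => x i) - network d W fun i => x i) i ^ 2)
      (fun i _ => sq_nonneg _) (Finset.mem_univ (Fin.castLE hK j))
  refine hcoord.trans ((pow_le_pow_left₀ (norm_nonneg _) hnet2 2).trans ?_)
  -- Cauchy–Schwarz over the `d` layers, the source of `√d` in the sensitivity matrices.
  have cs : (∑ l, c l * specNorm (U l)) ^ 2 ≤ d * ∑ l, (c l * specNorm (U l)) ^ 2 := by
    simpa using sq_sum_le_card_mul_sum_sq (s := Finset.univ) (f := fun l => c l * specNorm (U l))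
  rw [mul_pow]
  refine (mul_le_mul_of_nonneg_left cs (sq_nonneg _)).trans ?_
  rw [← mul_assoc, Finset.mul_sum]
  refine Finset.sum_le_sum fun l _ => ?_
  have hsens : ∀ p, (sensitivity (h := h) B ψmin t w l).mulVec (u l) p =
      (Real.exp 1 * √(d : ℝ) * B * c l / ψmin) *
        (toeplitzSection (h * h) t).mulVec ((kernelMap h k).mulVec (u l)) p := fun p => by
    simp only [sensitivity, Matrix.smul_mulVec, Pi.smul_apply, smul_eq_mul, Matrix.mulVec_mulVec,
      c, W]
  simp_rw [hsens, mul_pow]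
  rw [← Finset.mul_sum]
  -- `T` expands the vectorized `U l` by at least `ψmin`, cancelling the denominator in
  -- `sensitivity`.
  have hT := mul_sum_sq_le_toeplitz ht hψ hle him ((kernelMap h k).mulVec (u l))
  rw [← sum_toep_sq] at hT
  have hF := specNorm_sq_le (U l)
  have h1 : ψmin ^ 2 * specNorm (U l) ^ 2 ≤
      ∑ p, (toeplitzSection (h * h) t).mulVec ((kernelMap h k).mulVec (u l)) p ^ 2 :=
    (mul_le_mul_of_nonneg_left hF (sq_nonneg _)).trans hT
  refine le_trans (le_of_eq ?_) (mul_le_mul_of_nonneg_left h1 (sq_nonneg _))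
  rw [div_pow, mul_pow, mul_pow, mul_pow, Real.sq_sqrt hd'.le]
  field_simp

end Dominance

end ToepNet

end

theorem theorem4 :
    ∃ C : ℝ, 0 < C ∧
      ∀ (d h k K m : ℕ) (hK : K ≤ h), 1 ≤ d → 1 ≤ k → 2 ≤ K → 1 ≤ m →
      ∀ (B ψmin ψmax : ℝ), 0 < B → 0 < ψmin →
      ∀ t : ℤ → ℝ, Summable t →
      (∀ ω ∈ Set.Icc (0 : ℝ) (2 * Real.pi),
        ‖ToepNet.symbol t ω‖ ∈ Set.Icc ψmin ψmax) →
      -- for a real-valued symbol, the matrices `A_l` dominate the output perturbation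
      ((∀ ω ∈ Set.Icc (0 : ℝ) (2 * Real.pi), (ToepNet.symbol t ω).im = 0) →
        ∀ w u : Fin d → Fin k → ℝ,
          (∀ l, ToepNet.specNorm (ToepNet.toep h (u l)) ≤
            1 / (d : ℝ) * ToepNet.specNorm (ToepNet.toep h (w l))) →
          ∀ x : EuclideanSpace ℝ (Fin h), ‖x‖ ≤ B → ∀ j : Fin K,
            |ToepNet.convNet hK (w + u) x j - ToepNet.convNet hK w x j| ^ 2 ≤
              ∑ l, ∑ p, ((ToepNet.sensitivity (h := h) B ψmin t w l).mulVec (u l) p) ^ 2) ∧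
      -- the generalization bound, simultaneously for all kernels
      ∀ D : MeasureTheory.Measure (EuclideanSpace ℝ (Fin h) × Fin K),
        MeasureTheory.IsProbabilityMeasure D → (∀ᵐ z ∂D, ‖z.1‖ ≤ B) →
        ∀ γ δ : ℝ, 0 < γ → 0 < δ →
          MeasureTheory.Measure.pi (fun _ : Fin m => D)
            {S | ¬ ∀ w : Fin d → Fin k → ℝ,
              ToepNet.marginLoss D 0 (ToepNet.convNet hK w) ≤
                ToepNet.empMarginLoss S γ (ToepNet.convNet hK w) +
                C * √((B ^ 2 * (d : ℝ) ^ 2 * k * ToepNet.kernelComplexity ψmin ψmax w +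
                    max 1 (γ ^ 2) * Real.log (m * d / δ)) / (γ ^ 2 * m))}
            ≤ ENNReal.ofReal δ := by
  refine ⟨500, by norm_num, fun d h k K m hK hd _ h2K hm B ψmin ψmax hB hψ t ht hsym =>
    ⟨fun him w u hu x hx j => ?_, fun D hDp hD γ δ hγ hδ => ?_⟩⟩
  · exact ToepNet.sensitivity_dominates hK hd hψ ht (fun ω hω => (hsym ω hω).1) him w u hu hx j
  -- Any frequency yields `ψmin ≤ ψmax`.
  · have h0 := hsym 0 ⟨le_rfl, by positivity⟩
    exact ToepNet.pi_generalization hK hd h2K hm hB hψ (h0.1.trans h0.2) D hD hγ hδ
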